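/- Let $0<\alpha<1$ and let $k\ge 1$ be a fixed integer. For $D\ge 1$ put $\Gamma_\alpha(D)=\sum_{i=1}^{D} i^{-\alpha}$; an i.i.d. Zipf stream with skew $\alpha$ over $\{1,\dots,D\}$ is a sequence of independent random items in which each item $i$ appears with probability $i^{-\alpha}/\Gamma_\alpha(D)$. A counter algorithm with $m$ counters keeps a table of at most $m$ monitored items, initially empty, each with a counter. When an item $x$ arrives: if $x$ is monitored, its counter is incremented; otherwise, if fewer than $m$ items are monitored, $x$ becomes monitored with counter $1$; otherwise $x$ is admitted or discarded. If $x$ is admitted, it replaces a monitored item $y$ whose counter value $c_y$ is minimal (ties are broken by an arbitrary fixed rule depending on the table) and receives the counter value $c_y+1$; if it is discarded, nothing changes. Space Saving admits always. RAP$'$ admits with a constant probability $P$, by independent coin tosses that are independent of the stream. An algorithm with $m$ counters solves top-$k$ if the probability that, after $t$ arrivals, all of the items $1,\dots,k$ are monitored and their counters are larger than all other counters in the table tends to $1$ as $t\to\infty$. (1) Space Saving requires $\Theta(D^{1-\alpha})$ counters to solve top-$k$ on the Zipf stream: there are constants $c,C>0$, depending only on $\alpha$ and $k$, such that for all sufficiently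 large $D$, if Space Saving solves top-$k$ with $m$ counters then $m\ge c\,D^{1-\alpha}$, and it does solve top-$k$ with every number $m\ge C\,D^{1-\alpha}$ of counters. (2) RAP$'$ with admission probability $P=D^{(\alpha^2-\alpha)/(1+\alpha)}$ requires only $O\bigl(D^{(1-\alpha)/(1+\alpha)}\bigr)$ counters: there is a constant $c_0>0$, depending only on $\alpha$ and $k$, such that for every $c\ge c_0$ and all sufficiently large $D$ (depending on $\alpha,k,c$), RAP$'$ solves top-$k$ on the Zipf stream with every number $m$ of counters satisfying $c_0 D^{(1-\alpha)/(1+\alpha)}\le m\le c\,D^{(1-\alpha)/(1+\alpha)}$. -/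

import Mathlib

open MeasureTheory ProbabilityTheory Filter Topology

/-- The normalizing constant `Γ_α(D) = ∑_{i=1}^D i^{-α}`. -/
noncomputable def zipfGamma (α : ℝ) (D : ℕ) : ℝ :=
  ∑ i ∈ Finset.Icc 1 D, (i : ℝ) ^ (-α)

/-- `X 0, X 1, …` is an i.i.d. Zipf stream with skew `α` over the domain `{1, …, D}`: the elements
are independent and item `i` appears with probability `i^{-α} / Γ_α(D)`. -/
structure IsZipfStream {Ω : Type*} [MeasurableSpace Ω] (μ : Measure Ω) (α : ℝ) (D : ℕ)
    (X : ℕ → Ω → ℕ) : Prop where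
  measurable : ∀ t, Measurable (X t)
  indep : iIndepFun X μ
  law : ∀ t, ∀ i ∈ Finset.Icc 1 D, μ.real {ω | X t ω = i} = (i : ℝ) ^ (-α) / zipfGamma α D

/-- `B 0, B 1, …` are independent coins with success probability `P`, tossed independently of the
stream `X`. -/
structure IsAdmissionCoins {Ω : Type*} [MeasurableSpace Ω] (μ : Measure Ω) (P : ℝ)
    (X : ℕ → Ω → ℕ) (B : ℕ → Ω → Bool) : Prop where
  measurable : ∀ t, Measurable (B t)
  indep : iIndepFun B μ
  law : ∀ t, μ.real {ω | B t ω = true} = P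
  indep_stream : IndepFun (fun ω t => X t ω) (fun ω t => B t ω) μ

/-- The state of a counter-based algorithm: the finite set `C` of monitored items and the counter
values `c` (only the values on `C` are meaningful). -/
@[ext]
structure CounterTable where
  C : Finset ℕ
  c : ℕ → ℕ

/-- `sel` is a rule that selects a monitored item of minimal counter value, with arbitrary
tie-breaking. -/
def IsArgmin (sel : CounterTable → ℕ) : Prop :=
  ∀ T : CounterTable, T.C.Nonempty → sel T ∈ T.C ∧ ∀ y ∈ T.C, T.c (sel T) ≤ T.c y

/-- Processing of an arriving item `x` with `m` counters. A monitored item has its counter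
incremented; an unmonitored item gets a fresh counter with value `1` as long as there is one; when
the table is full, the unmonitored item takes over the minimal counter and increments it, provided
that it is admitted (`accept = true`), and is discarded otherwise. (The table is full and empty only
when `m = 0`, and then nothing happens.) -/
def CounterTable.add (sel : CounterTable → ℕ) (m : ℕ) (accept : Bool) (x : ℕ)
    (T : CounterTable) : CounterTable :=
  if x ∈ T.C then
    ⟨T.C, Function.update T.c x (T.c x + 1)⟩
  else if T.C.card < m then
    ⟨insert x T.C, Function.update T.c x 1⟩
  else if T.C.Nonempty ∧ accept = true then
    ⟨insert x (T.C.erase (sel T)), Function.update T.c x (T.c (sel T) + 1)⟩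
  else T

/-- The randomized admission algorithm with `m` counters, after the first `t` elements of the
stream `x`, where `b s` tells whether the element `x s` is admitted if it finds the table full and
is not monitored. -/
def rapRun (sel : CounterTable → ℕ) (m : ℕ) (x : ℕ → ℕ) (b : ℕ → Bool) : ℕ → CounterTable
  | 0 => ⟨∅, fun _ => 0⟩
  | t + 1 => (rapRun sel m x b t).add sel m (b t) (x t)

/-- Space Saving with `m` counters, after the first `t` elements of the stream `x`: every arriving
item is admitted. -/
def spaceSavingRun (sel : CounterTable → ℕ) (m : ℕ) (x : ℕ → ℕ) (t : ℕ) : CounterTable :=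
  rapRun sel m x (fun _ => true) t

/-- The `k` largest counters of the table are allocated for the items `1, …, k`. -/
def IdentifiesTop (k : ℕ) (T : CounterTable) : Prop :=
  ∀ i ∈ Finset.Icc 1 k, i ∈ T.C ∧ ∀ j ∈ T.C, j ∉ Finset.Icc 1 k → T.c j < T.c i

/-- Space Saving with `m` counters solves top-`k` on the random stream `X`: the probability that it
has identified the top-`k` items at time `t` tends to `1` as `t → ∞`. -/
def SpaceSavingSolves {Ω : Type*} [MeasurableSpace Ω] (μ : Measure Ω) (X : ℕ → Ω → ℕ)
    (sel : CounterTable → ℕ) (k m : ℕ) : Prop :=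
  Tendsto (fun t => μ.real {ω | IdentifiesTop k (spaceSavingRun sel m (fun s => X s ω) t)})
    atTop (𝓝 1)

/-- The randomized admission algorithm with `m` counters and admission coins `B` solves top-`k` on
the random stream `X`: the probability that it has identified the top-`k` items at time `t` tends
to `1` as `t → ∞`. -/
def RapSolves {Ω : Type*} [MeasurableSpace Ω] (μ : Measure Ω) (X : ℕ → Ω → ℕ)
    (B : ℕ → Ω → Bool) (sel : CounterTable → ℕ) (k m : ℕ) : Prop :=
  Tendsto
    (fun t => μ.real {ω | IdentifiesTop k (rapRun sel m (fun s => X s ω) (fun s => B s ω) t)})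
    atTop (𝓝 1)

/-!
**Space Saving.** The counters add up to `t`, so the largest one is at least `t / m`. If it grows, it
becomes the counter of the arriving item, which is then a top item unless the new table fails to
identify these (`sup_add_le`). Hence its expected growth per step is at most the probability of a
top item, of order `D ^ (α - 1)`, plus a quantity that tends to `0` if the top items are identified
(`one_le_of_spaceSavingSolves`). Conversely, counters overestimate frequencies by at most the
minimal counter value, which is at most `t / m` (`rapRun_counter_le`, `arrivals_le_estimate`), and
the law of large numbers for the frequencies suffices (`spaceSavingSolves_of_gap`).

**Randomized admission.** Let `M = D ^ ((1 - α) / (1 + α))`, so that `P = M ^ (-α)`, and `Γ` is of the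
order `M ^ (1 + α)`. Monitored items arrive with a probability `ps` of the order
`m ^ (1 - α) / Γ`, which is less than `P`, so the sum of the counters grows at a rate of at most
`ps + P` and the minimum at a rate of at most `(ps + P) / m`, a small fraction of `1 / Γ` if
`m / M` is large. Again counters overestimate frequencies by at most the minimum, and it remains to
see that an item `i ≤ k` is monitored forever from some time on (`ae_eventually_mem`).

Once its counter exceeds the minimum, `i` gains on the minimum on average, since during the time in
which the minimum climbs by one, `i` is expected to arrive many times. This can fail for a level that
starts with few minimal counters. Such levels are rare compared to the admissions of `i`, because a
counter that is above the minimum when a level starts got there by an arrival of its own item. This is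
expressed by a single Lyapunov function `lyapunov`. It combines the risk of `i`, the height of the
counters above the minimum, the level of the minimum, the counter of `i` and the sum of all counters.
Its mean change is negative whatever the table is (`lyapunov_add_le`,
`integral_lyapunovGain_le`), so by exponential moments and the Borel–Cantelli lemma it tends to
`-∞` almost surely (`ae_eventually_sum_nonpos`), whereas it is nonnegative whenever `i` is not
monitored (`lyapunov_nonneg`).
-/

/-! ### The elementary step of a counter table -/

namespace CounterTable

/-- The monitored item `z` gives its counter to `y`, and the counter is incremented. This covers
both the arrival of a monitored item (`y = z`) and the replacement of `z` by a new item `y`. -/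
def bump (T : CounterTable) (z y : ℕ) : CounterTable :=
  ⟨insert y (T.C.erase z), Function.update T.c y (T.c z + 1)⟩

/-- The number of monitored items whose counter has the minimal value. -/
def minCount (sel : CounterTable → ℕ) (T : CounterTable) : ℕ :=
  (T.C.filter fun y => T.c y = T.c (sel T)).card

/-- The sum of all counters. -/
def total (T : CounterTable) : ℕ := ∑ y ∈ T.C, T.c y

/-- The total height of the counters above the level that follows the minimal one (the subtraction
of natural numbers takes the positive part). -/
def excess (sel : CounterTable → ℕ) (T : CounterTable) : ℕ :=
  ∑ y ∈ T.C, (T.c y - (T.c (sel T) + 1))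

/-- The minimal counter value, where an unused counter is regarded as a counter of value `0`. -/
def level (sel : CounterTable → ℕ) (m : ℕ) (T : CounterTable) : ℕ :=
  if T.C.card < m then 0 else T.c (sel T)

variable {sel : CounterTable → ℕ} {T : CounterTable} {m x y z : ℕ} {a : Bool}

lemma add_of_mem (hx : x ∈ T.C) : T.add sel m a x = T.bump x x := by
  simp [add, bump, hx, Finset.insert_erase hx]

lemma add_of_notMem_of_lt (hx : x ∉ T.C) (hT : T.C.card < m) :
    T.add sel m a x = ⟨insert x T.C, Function.update T.c x 1⟩ := by
  simp [add, hx, hT]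

lemma add_of_notMem_of_full (hx : x ∉ T.C) (hT : ¬ T.C.card < m) (hne : T.C.Nonempty) :
    T.add sel m true x = T.bump (sel T) x := by
  simp [add, hx, hT, hne, bump]

lemma add_of_rejected (hx : x ∉ T.C) (hT : ¬ T.C.card < m) :
    T.add sel m false x = T := by
  simp [add, hx, hT]

lemma c_sel_eq (hsel : IsArgmin sel) {l : ℕ} (h₁ : ∃ y ∈ T.C, T.c y = l)
    (h₂ : ∀ y ∈ T.C, l ≤ T.c y) : T.c (sel T) = l := by
  obtain ⟨y, hy, rfl⟩ := h₁
  obtain ⟨hs, hs'⟩ := hsel T ⟨y, hy⟩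
  exact le_antisymm (hs' y hy) (h₂ _ hs)

lemma sum_bump {M : Type*} [AddCommMonoid M] (hz : z ∈ T.C) (hy : y ∉ T.C.erase z) (h : ℕ → M) :
    ∑ w ∈ (T.bump z y).C, h ((T.bump z y).c w) + h (T.c z) =
      ∑ w ∈ T.C, h (T.c w) + h (T.c z + 1) := by
  have h1 : ∑ w ∈ T.C.erase z, h (Function.update T.c y (T.c z + 1) w)
      = ∑ w ∈ T.C.erase z, h (T.c w) := by
    refine Finset.sum_congr rfl fun w hw => ?_
    rw [Function.update_of_ne]
    rintro rfl
    exact hy hw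
  simp only [bump]
  rw [Finset.sum_insert hy, h1, Function.update_self, ← Finset.sum_erase_add _ _ hz]
  ac_rfl

lemma card_bump (hz : z ∈ T.C) (hy : y ∉ T.C.erase z) : (T.bump z y).C.card = T.C.card := by
  have := sum_bump hz hy (fun _ => 1)
  simpa using this

lemma total_bump (hz : z ∈ T.C) (hy : y ∉ T.C.erase z) :
    (T.bump z y).total = T.total + 1 := by
  have := sum_bump hz hy id
  simp only [id] at this
  unfold total
  omega

lemma bump_c_of_ne {w : ℕ} (h : w ≠ y) : (T.bump z y).c w = T.c w := by
  simp [bump, h]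

lemma bump_c_self : (T.bump z y).c y = T.c z + 1 := by simp [bump]

lemma mem_bump {w : ℕ} : w ∈ (T.bump z y).C ↔ w = y ∨ (w ≠ z ∧ w ∈ T.C) := by
  simp [bump]

/-- After a bump each counter is either the one that was incremented or an old one. -/
lemma bump_c_cases {w : ℕ} (hy : y ∉ T.C.erase z) (hw : w ∈ (T.bump z y).C) :
    (w = y ∧ (T.bump z y).c w = T.c z + 1) ∨
      (w ≠ z ∧ w ∈ T.C ∧ w ≠ y ∧ (T.bump z y).c w = T.c w) := by
  rcases eq_or_ne w y with rfl | hne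
  · exact .inl ⟨rfl, bump_c_self⟩
  · have := (mem_bump.1 hw).resolve_left hne
    exact .inr ⟨this.1, this.2, hne, bump_c_of_ne hne⟩

lemma minCount_eq_sum : minCount sel T = ∑ w ∈ T.C, if T.c w = T.c (sel T) then 1 else 0 := by
  simp [minCount]

/-- Incrementing a counter above the minimum. -/
lemma bump_of_gt (hsel : IsArgmin sel) (hz : z ∈ T.C) (hy : y ∉ T.C.erase z)
    (hgt : T.c (sel T) < T.c z) :
    (T.bump z y).c (sel (T.bump z y)) = T.c (sel T) ∧
      minCount sel (T.bump z y) = minCount sel T ∧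
      excess sel (T.bump z y) = excess sel T + 1 := by
  obtain ⟨hs, hmin⟩ := hsel T ⟨z, hz⟩
  have hne : sel T ≠ z := by rintro h; rw [h] at hgt; exact lt_irrefl _ hgt
  have hl : (T.bump z y).c (sel (T.bump z y)) = T.c (sel T) := by
    refine c_sel_eq hsel ⟨sel T, mem_bump.2 (.inr ⟨hne, hs⟩), bump_c_of_ne ?_⟩ fun w hw => ?_
    · rintro rfl
      exact hy (Finset.mem_erase.2 ⟨hne, hs⟩)
    · rcases bump_c_cases hy hw with ⟨-, h⟩ | ⟨-, h, -, h'⟩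
      · omega
      · rw [h']; exact hmin w h
  refine ⟨hl, ?_, ?_⟩
  · have := sum_bump hz hy (fun v => if v = T.c (sel T) then 1 else 0)
    simp only [show T.c z ≠ T.c (sel T) by omega, show T.c z + 1 ≠ T.c (sel T) by omega,
      if_false, add_zero] at this
    rw [minCount_eq_sum, minCount_eq_sum, hl, this]
  · have := sum_bump hz hy (fun v => v - (T.c (sel T) + 1))
    simp only [excess, hl]
    omega

lemma one_le_minCount (hsel : IsArgmin sel) (hT : T.C.Nonempty) : 1 ≤ minCount sel T :=
  Finset.card_pos.2 ⟨sel T, Finset.mem_filter.2 ⟨(hsel T hT).1, rfl⟩⟩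

/-- Incrementing a minimal counter that is not the only one. -/
lemma bump_of_eq (hsel : IsArgmin sel) (hz : z ∈ T.C) (hy : y ∉ T.C.erase z)
    (heq : T.c z = T.c (sel T)) (hn : 1 < minCount sel T) :
    (T.bump z y).c (sel (T.bump z y)) = T.c (sel T) ∧
      minCount sel (T.bump z y) + 1 = minCount sel T ∧
      excess sel (T.bump z y) = excess sel T := by
  obtain ⟨hs, hmin⟩ := hsel T ⟨z, hz⟩
  obtain ⟨w, hw, hwz⟩ := Finset.exists_mem_ne hn z
  rw [Finset.mem_filter] at hw
  have hl : (T.bump z y).c (sel (T.bump z y)) = T.c (sel T) := by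
    refine c_sel_eq hsel ⟨w, mem_bump.2 (.inr ⟨hwz, hw.1⟩), ?_⟩ fun v hv => ?_
    · rw [bump_c_of_ne, hw.2]
      rintro rfl
      exact hy (Finset.mem_erase.2 ⟨hwz, hw.1⟩)
    · rcases bump_c_cases hy hv with ⟨-, h⟩ | ⟨-, h, -, h'⟩
      · omega
      · rw [h']; exact hmin v h
  refine ⟨hl, ?_, ?_⟩
  · have := sum_bump hz hy (fun v => if v = T.c (sel T) then 1 else 0)
    simp only [heq, show T.c (sel T) + 1 ≠ T.c (sel T) by omega,
      if_false, if_true, add_zero] at this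
    rw [minCount_eq_sum, minCount_eq_sum, hl, this]
  · have := sum_bump hz hy (fun v => v - (T.c (sel T) + 1))
    simp only [excess, hl]
    omega

/-- Incrementing the only minimal counter raises the minimum by one. The excess drops by the number
of counters above the new minimum. -/
lemma bump_of_unique (hsel : IsArgmin sel) (hz : z ∈ T.C) (hy : y ∉ T.C.erase z)
    (heq : T.c z = T.c (sel T)) (hn : minCount sel T = 1) :
    (T.bump z y).c (sel (T.bump z y)) = T.c (sel T) + 1 ∧
      excess sel (T.bump z y) + T.C.card = excess sel T + minCount sel (T.bump z y) := by
  obtain ⟨hs, hmin⟩ := hsel T ⟨z, hz⟩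
  have hgt : ∀ w ∈ T.C, w ≠ z → T.c (sel T) + 1 ≤ T.c w := by
    intro w hw hwz
    refine lt_of_le_of_ne (hmin w hw) fun h => hwz ?_
    exact Finset.card_le_one.1 hn.le w (Finset.mem_filter.2 ⟨hw, h.symm⟩) z
      (Finset.mem_filter.2 ⟨hz, heq⟩)
  have hge : ∀ w ∈ (T.bump z y).C, T.c (sel T) + 1 ≤ (T.bump z y).c w := by
    intro w hw
    rcases bump_c_cases hy hw with ⟨-, h⟩ | ⟨h₁, h, -, h'⟩
    · omega
    · rw [h']; exact hgt w h h₁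
  have hl : (T.bump z y).c (sel (T.bump z y)) = T.c (sel T) + 1 :=
    c_sel_eq hsel ⟨y, mem_bump.2 (.inl rfl), by rw [bump_c_self, heq]⟩ hge
  refine ⟨hl, ?_⟩
  have h1 := sum_bump hz hy (fun v => v - (T.c (sel T) + 1))
  have h2 : ∑ w ∈ (T.bump z y).C, ((T.bump z y).c w - (T.c (sel T) + 1)) +
      ∑ w ∈ (T.bump z y).C, (if (T.bump z y).c w = T.c (sel T) + 1 then 1 else 0)
      = ∑ w ∈ (T.bump z y).C, ((T.bump z y).c w - (T.c (sel T) + 1 + 1)) +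
        (T.bump z y).C.card := by
    rw [Finset.card_eq_sum_ones, ← Finset.sum_add_distrib, ← Finset.sum_add_distrib]
    refine Finset.sum_congr rfl fun w hw => ?_
    have := hge w hw
    split_ifs <;> omega
  rw [card_bump hz hy] at h2
  simp only [heq] at h1
  rw [minCount_eq_sum]
  simp only [excess, hl]
  omega

/-! ### Deterministic bounds along a run -/

lemma level_of_full (hT : T.C.card = m) : level sel m T = T.c (sel T) := by
  simp [level, hT]

lemma level_of_lt (hT : T.C.card < m) : level sel m T = 0 := by simp [level, hT]

lemma level_le (hsel : IsArgmin sel) (hy : y ∈ T.C) : level sel m T ≤ T.c y := by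
  unfold level
  split_ifs
  · exact Nat.zero_le _
  · exact (hsel T ⟨y, hy⟩).2 y hy

lemma mul_level_le_total (hsel : IsArgmin sel) (hT : T.C.card ≤ m) :
    m * level sel m T ≤ T.total := by
  rcases hT.lt_or_eq with h | h
  · simp [level_of_lt h]
  · rw [← h, total, ← smul_eq_mul]
    exact Finset.card_nsmul_le_sum _ _ _ fun y hy => level_le hsel hy

lemma minCount_le_card : minCount sel T ≤ T.C.card := Finset.card_filter_le _ _

lemma bump_c_sel (hsel : IsArgmin sel) (hz : z ∈ T.C) (hy : y ∉ T.C.erase z) :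
    T.c (sel T) ≤ (T.bump z y).c (sel (T.bump z y)) := by
  obtain ⟨hs, hmin⟩ := hsel T ⟨z, hz⟩
  have hne : (T.bump z y).C.Nonempty := ⟨y, mem_bump.2 (.inl rfl)⟩
  rcases bump_c_cases hy (hsel _ hne).1 with ⟨-, h⟩ | ⟨-, h, -, h'⟩
  · rw [h]; exact (hmin z hz).trans (Nat.le_succ _)
  · rw [h']; exact hmin _ h

/-- The possible effects of an arrival: a monitored item, a free counter, a replacement,
or a rejection. -/
lemma add_cases (hsel : IsArgmin sel) (hT : T.C.card ≤ m) (hm : 1 ≤ m) (a : Bool) (x : ℕ) :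
    (x ∈ T.C ∧ T.add sel m a x = T.bump x x) ∨
    (x ∉ T.C ∧ T.C.card < m ∧ T.add sel m a x = ⟨insert x T.C, Function.update T.c x 1⟩) ∨
    (x ∉ T.C ∧ T.C.card = m ∧ a = true ∧ sel T ∈ T.C ∧ T.add sel m a x = T.bump (sel T) x) ∨
    (x ∉ T.C ∧ T.C.card = m ∧ a = false ∧ T.add sel m a x = T) := by
  by_cases hx : x ∈ T.C
  · exact .inl ⟨hx, add_of_mem hx⟩
  rcases hT.lt_or_eq with h | h
  · exact .inr (.inl ⟨hx, h, add_of_notMem_of_lt hx h⟩)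
  have hne : T.C.Nonempty := Finset.card_pos.1 (by omega)
  cases a
  · exact .inr (.inr (.inr ⟨hx, h, rfl, add_of_rejected hx h.not_lt⟩))
  · exact .inr (.inr (.inl ⟨hx, h, rfl, (hsel T hne).1, add_of_notMem_of_full hx h.not_lt hne⟩))

lemma card_add_le (hsel : IsArgmin sel) (hT : T.C.card ≤ m) :
    (T.add sel m a x).C.card ≤ m := by
  rcases Nat.eq_zero_or_pos m with rfl | hm
  · have : T.C = ∅ := Finset.card_eq_zero.1 (Nat.le_zero.1 hT)
    simp [add, this]
  rcases add_cases hsel hT hm a x with ⟨h, e⟩ | ⟨h, h', e⟩ | ⟨h, h', -, hs, e⟩ | ⟨h, h', -, e⟩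
  · rw [e, card_bump h (by simp)]; exact hT
  · rw [e]; simp only; rw [Finset.card_insert_of_notMem h]; exact h'
  · rw [e, card_bump hs (fun H => h (Finset.mem_of_mem_erase H))]; exact hT
  · rw [e]; exact hT

lemma card_le_card_add (hsel : IsArgmin sel) (hT : T.C.card ≤ m) :
    T.C.card ≤ (T.add sel m a x).C.card := by
  rcases Nat.eq_zero_or_pos m with rfl | hm
  · omega
  rcases add_cases hsel hT hm a x with ⟨h, e⟩ | ⟨h, h', e⟩ | ⟨h, h', -, hs, e⟩ | ⟨h, h', -, e⟩
  · rw [e, card_bump h (by simp)]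
  · rw [e]; simp only; rw [Finset.card_insert_of_notMem h]; omega
  · rw [e, card_bump hs (fun H => h (Finset.mem_of_mem_erase H))]
  · rw [e]

lemma level_add (hsel : IsArgmin sel) (hT : T.C.card ≤ m) (hm : 1 ≤ m) :
    level sel m T ≤ level sel m (T.add sel m a x) := by
  rcases hT.lt_or_eq with h | h
  · rw [level_of_lt h]; exact Nat.zero_le _
  have h2 : (T.add sel m a x).C.card = m :=
    le_antisymm (card_add_le hsel hT) (h.symm.le.trans (card_le_card_add hsel hT))
  rw [level_of_full h, level_of_full h2]
  rcases add_cases hsel hT hm a x with ⟨h, e⟩ | ⟨h, h', e⟩ | ⟨h, h', -, hs, e⟩ | ⟨h, h', -, e⟩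
  · rw [e]; exact bump_c_sel hsel h (by simp)
  · omega
  · rw [e]; exact bump_c_sel hsel hs (fun H => h (Finset.mem_of_mem_erase H))
  · rw [e]

/-- The counter of `i`, where an unmonitored item is given the minimal counter value. -/
def estimate (sel : CounterTable → ℕ) (m i : ℕ) (T : CounterTable) : ℕ :=
  if i ∈ T.C then T.c i else level sel m T

/-- The estimate of an item never decreases, and it increases whenever the item arrives and is
monitored or admitted. -/
lemma estimate_add (hsel : IsArgmin sel) (hT : T.C.card ≤ m) (hm : 1 ≤ m) (i : ℕ) :
    estimate sel m i T + (if x = i ∧ (i ∈ T.C ∨ a = true) then 1 else 0) ≤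
      estimate sel m i (T.add sel m a x) := by
  have hlev := level_add (a := a) (x := x) hsel hT hm
  by_cases hi' : i ∈ (T.add sel m a x).C
  swap
  · have hi : i ∈ T.C → T.c i ≤ level sel m T ∧ x ≠ i := by
      intro hi
      rcases add_cases hsel hT hm a x with
        ⟨h, e⟩ | ⟨h, h', e⟩ | ⟨h, h', -, hs, e⟩ | ⟨h, h', -, e⟩
      · rw [e, mem_bump] at hi'; exact absurd hi (by tauto)
      · rw [e] at hi'; simp [hi] at hi'
      · rw [e, mem_bump] at hi'
        have : i = sel T := by tauto
        rw [level_of_full h', this]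
        exact ⟨le_rfl, fun H => h (H.symm ▸ this ▸ hs)⟩
      · rw [e] at hi'; exact absurd hi hi'
    have hx : x = i → ¬ (i ∈ T.C ∨ a = true) := by
      rintro rfl (h | h)
      · exact (hi h).2 rfl
      · refine hi' ?_
        rcases add_cases hsel hT hm a x with
          ⟨h, e⟩ | ⟨h, h', e⟩ | ⟨h, h', -, hs, e⟩ | ⟨h, h', h'', e⟩
        · rw [e]; exact mem_bump.2 (.inl rfl)
        · rw [e]; simp
        · rw [e]; exact mem_bump.2 (.inl rfl)
        · simp_all
    simp only [estimate, if_neg hi']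
    rw [if_neg (show ¬ (x = i ∧ (i ∈ T.C ∨ a = true)) from fun h => hx h.1 h.2)]
    by_cases h : i ∈ T.C
    · rw [if_pos h]; have := (hi h).1; omega
    · rw [if_neg h]; exact hlev
  · simp only [estimate, if_pos hi']
    rcases add_cases hsel hT hm a x with
      ⟨h, e⟩ | ⟨h, h', e⟩ | ⟨h, h', -, hs, e⟩ | ⟨h, h', h'', e⟩
    · rw [e, mem_bump] at hi'
      have hi : i ∈ T.C := by rcases hi' with rfl | h' <;> tauto
      rw [e, if_pos hi]
      rcases eq_or_ne i x with rfl | hne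
      · rw [bump_c_self]; split_ifs <;> omega
      · rw [bump_c_of_ne hne, if_neg (fun H => hne H.1.symm)]; omega
    · rw [e]
      rcases eq_or_ne i x with rfl | hne
      · rw [if_neg h, level_of_lt h']; simp only [Function.update_self]; split_ifs <;> omega
      · rw [e] at hi'
        have hi : i ∈ T.C := by simpa [hne] using hi'
        rw [if_pos hi, if_neg (fun H => hne H.1.symm)]; simp [hne]
    · rw [e]
      rcases eq_or_ne i x with rfl | hne
      · rw [if_neg h, level_of_full h', bump_c_self]; split_ifs <;> omega
      · rw [e, mem_bump] at hi'
        rw [bump_c_of_ne hne, if_pos (by tauto), if_neg (fun H => hne H.1.symm)]; omega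
    · rw [e] at hi' ⊢
      have hne : x ≠ i := fun H => h (H ▸ hi')
      rw [if_pos hi', if_neg (fun H => hne H.1)]; omega

end CounterTable

/-- The number of occurrences of `j` among the first `t` elements of the stream `x`. -/
def arrivals (x : ℕ → ℕ) (j t : ℕ) : ℕ := ∑ s ∈ Finset.range t, if x s = j then 1 else 0

section Run

open CounterTable

variable {sel : CounterTable → ℕ} {m : ℕ} {x : ℕ → ℕ} {b : ℕ → Bool}

lemma arrivals_succ (x : ℕ → ℕ) (j t : ℕ) :
    arrivals x j (t + 1) = arrivals x j t + if x t = j then 1 else 0 :=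
  Finset.sum_range_succ _ _

lemma card_rapRun_le (hsel : IsArgmin sel) (t : ℕ) : (rapRun sel m x b t).C.card ≤ m := by
  induction t with
  | zero => simp [rapRun]
  | succ t ih => exact card_add_le hsel ih

lemma rapRun_congr {x' : ℕ → ℕ} {b' : ℕ → Bool} {t : ℕ} (hx : ∀ s < t, x s = x' s)
    (hb : ∀ s < t, b s = b' s) : rapRun sel m x b t = rapRun sel m x' b' t := by
  induction t with
  | zero => rfl
  | succ t ih =>
    simp only [rapRun]
    rw [ih (fun s hs => hx s (hs.trans t.lt_succ_self)) (fun s hs => hb s (hs.trans t.lt_succ_self)),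
      hx t t.lt_succ_self, hb t t.lt_succ_self]

/-- A counter overestimates the frequency of its item by at most the minimal counter value: an item
that enters a full table starts from the minimum of that time, and the minimum never decreases. -/
lemma rapRun_counter_le (hsel : IsArgmin sel) (hm : 1 ≤ m) (j t : ℕ)
    (hj : j ∈ (rapRun sel m x b t).C) :
    (rapRun sel m x b t).c j ≤ arrivals x j t + level sel m (rapRun sel m x b t) := by
  induction t with
  | zero => simp [rapRun] at hj
  | succ t ih =>
    have hlev := level_add (a := b t) (x := x t) hsel (card_rapRun_le (x := x) (b := b) hsel t) hm
    rw [arrivals_succ]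
    simp only [rapRun] at hj ⊢
    generalize rapRun sel m x b t = T at *
    rcases eq_or_ne j (x t) with rfl | hne
    · rw [if_pos rfl]
      by_cases hx : x t ∈ T.C
      · have := ih hx
        rw [add_of_mem hx] at hlev ⊢
        rw [bump_c_self]
        omega
      by_cases hT : T.C.card < m
      · rw [add_of_notMem_of_lt hx hT] at hlev ⊢
        simp only [Function.update_self]
        omega
      · by_cases hb : T.C.Nonempty ∧ b t = true
        · rw [hb.2, add_of_notMem_of_full hx hT hb.1] at hlev ⊢
          rw [bump_c_self]
          rw [level, if_neg hT] at hlev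
          omega
        · simp [CounterTable.add, hx, hT, hb] at hj
    · have h1 : j ∈ T.C ∧ (T.add sel m (b t) (x t)).c j = T.c j := by
        simp only [CounterTable.add] at hj ⊢
        split_ifs at hj ⊢ <;> simp_all
      have := ih h1.1
      rw [h1.2]
      omega

/-- As long as there are free counters, every item that has arrived is monitored. -/
lemma arrivals_eq_zero_of_lt (j t : ℕ)
    (hT : (rapRun sel m x b t).C.card < m) (hj : j ∉ (rapRun sel m x b t).C) :
    arrivals x j t = 0 := by
  induction t with
  | zero => simp [arrivals]
  | succ t ih =>
    rw [arrivals_succ]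
    simp only [rapRun] at hj hT
    generalize rapRun sel m x b t = T at *
    by_cases hx : x t ∈ T.C
    · rw [add_of_mem hx] at hj hT
      rw [card_bump hx (by simp)] at hT
      rw [mem_bump] at hj
      rw [ih hT (by tauto), if_neg (by tauto)]
    by_cases hT' : T.C.card < m
    · rw [add_of_notMem_of_lt hx hT'] at hj
      simp only [Finset.mem_insert, not_or] at hj
      rw [ih hT' hj.2, if_neg (fun h => hj.1 h.symm)]
    · simp only [CounterTable.add, hx, hT', if_false] at hT hj
      split_ifs at hT hj with h
      · refine absurd ?_ hT'
        refine lt_of_le_of_lt ?_ hT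
        simp only
        rw [Finset.card_insert_of_notMem (fun H => hx (Finset.mem_of_mem_erase H))]
        exact Nat.pred_le_iff.1 Finset.pred_card_le_card_erase
      · exact absurd hT hT'

/-- While an item is monitored, its counter counts its arrivals. -/
lemma arrivals_sub_le_counter (hsel : IsArgmin sel) (hm : 1 ≤ m) (i t₀ t : ℕ) (ht : t₀ ≤ t)
    (hi : ∀ s ≥ t₀, i ∈ (rapRun sel m x b s).C) :
    arrivals x i t ≤ arrivals x i t₀ + (rapRun sel m x b t).c i := by
  induction t, ht using Nat.le_induction with
  | base => omega
  | succ t ht ih =>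
    have h := estimate_add (a := b t) (x := x t) hsel (card_rapRun_le (x := x) (b := b) hsel t) hm i
    have h1 := hi (t + 1) (by omega)
    have h0 := hi t ht
    simp only [rapRun] at h1 ⊢
    simp only [estimate, h1, h0, if_true, true_or, and_true] at h
    rw [arrivals_succ]
    omega

/-- A table identifies the top items if some value separates their counters from the others. -/
lemma identifiesTop_of_threshold {k : ℕ} {T : CounterTable} (v : ℝ)
    (h₁ : ∀ i ∈ Finset.Icc 1 k, i ∈ T.C ∧ v < T.c i)
    (h₂ : ∀ j ∈ T.C, j ∉ Finset.Icc 1 k → (T.c j : ℝ) ≤ v) : IdentifiesTop k T := by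
  refine fun i hi => ⟨(h₁ i hi).1, fun j hj hjk => ?_⟩
  exact_mod_cast (h₂ j hj hjk).trans_lt (h₁ i hi).2

/-! ### Deterministic bounds for Space Saving -/

lemma total_add_true (hsel : IsArgmin sel) {T : CounterTable} (hT : T.C.card ≤ m) (hm : 1 ≤ m)
    (y : ℕ) : (T.add sel m true y).total = T.total + 1 := by
  rcases add_cases hsel hT hm true y with ⟨h, e⟩ | ⟨h, h', e⟩ | ⟨h, h', -, hs, e⟩ | ⟨h, h', h'', e⟩
  · rw [e, total_bump h (by simp)]
  · rw [e]
    simp only [total]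
    rw [Finset.sum_insert h, Function.update_self, add_comm]
    congr 1
    refine Finset.sum_congr rfl fun w hw => ?_
    rw [Function.update_of_ne]
    rintro rfl
    exact h hw
  · rw [e, total_bump hs (fun H => h (Finset.mem_of_mem_erase H))]
  · simp at h''

lemma total_spaceSavingRun (hsel : IsArgmin sel) (hm : 1 ≤ m) (t : ℕ) :
    (spaceSavingRun sel m x t).total = t := by
  induction t with
  | zero => simp [spaceSavingRun, rapRun, total]
  | succ t ih =>
    rw [spaceSavingRun, rapRun, total_add_true hsel (card_rapRun_le hsel t) hm]
    rw [spaceSavingRun] at ih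
    rw [ih]

lemma arrivals_le_estimate (hsel : IsArgmin sel) (hm : 1 ≤ m) (i t : ℕ) :
    arrivals x i t ≤ estimate sel m i (spaceSavingRun sel m x t) := by
  induction t with
  | zero => simp [arrivals]
  | succ t ih =>
    have h := estimate_add (a := true) (x := x t) hsel
      (card_rapRun_le (x := x) (b := fun _ => true) hsel t) hm i
    simp only [or_true, and_true] at h
    rw [arrivals_succ]
    simp only [spaceSavingRun, rapRun] at ih h ⊢
    omega

/-- If the largest counter grows, it becomes the counter of the arriving item, which is therefore
one of the top items if the new table identifies them. -/
lemma sup_add_le {T : CounterTable} {k : ℕ} (hk : 1 ≤ k) (hsel : IsArgmin sel)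
    (hT : T.C.card ≤ m) (hm : 1 ≤ m) (y : ℕ) [Decidable (IdentifiesTop k (T.add sel m true y))] :
    (T.add sel m true y).C.sup (T.add sel m true y).c ≤ T.C.sup T.c +
      ((if y ∈ Finset.Icc 1 k then 1 else 0) +
        if IdentifiesTop k (T.add sel m true y) then 0 else 1) := by
  -- the arriving item is monitored afterwards, and it alone may have gained
  have key : y ∈ (T.add sel m true y).C ∧ (T.add sel m true y).c y ≤ T.C.sup T.c + 1 ∧
      ∀ w ∈ (T.add sel m true y).C, w ≠ y → (T.add sel m true y).c w ≤ T.C.sup T.c := by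
    rcases add_cases hsel hT hm true y with
      ⟨h, e⟩ | ⟨h, h', e⟩ | ⟨h, h', -, hs, e⟩ | ⟨h, h', h'', e⟩
    · rw [e]
      refine ⟨mem_bump.2 (.inl rfl), ?_, fun w hw hne => ?_⟩
      · rw [bump_c_self]; exact Nat.succ_le_succ (Finset.le_sup (f := T.c) h)
      · rw [bump_c_of_ne hne]
        exact Finset.le_sup (f := T.c) ((mem_bump.1 hw).resolve_left hne).2
    · rw [e]
      refine ⟨by simp, by simp, fun w hw hne => ?_⟩
      simp only [Function.update_of_ne hne]
      exact Finset.le_sup (f := T.c) ((Finset.mem_insert.1 hw).resolve_left hne)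
    · rw [e]
      refine ⟨mem_bump.2 (.inl rfl), ?_, fun w hw hne => ?_⟩
      · rw [bump_c_self]; exact Nat.succ_le_succ (Finset.le_sup (f := T.c) hs)
      · rw [bump_c_of_ne hne]
        exact Finset.le_sup (f := T.c) ((mem_bump.1 hw).resolve_left hne).2
    · simp at h''
  generalize T.add sel m true y = T' at *
  obtain ⟨hy, h1, h2⟩ := key
  have hle : T'.C.sup T'.c ≤ T.C.sup T.c + 1 := by
    refine Finset.sup_le fun w hw => ?_
    rcases eq_or_ne w y with rfl | hne
    · exact h1
    · exact (h2 w hw hne).trans (Nat.le_succ _)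
  by_cases hyk : y ∈ Finset.Icc 1 k
  · rw [if_pos hyk]; omega
  by_cases hid : IdentifiesTop k T'
  swap
  · rw [if_neg hid]; omega
  rw [if_neg hyk, if_pos hid]
  have h1k : 1 ∈ Finset.Icc 1 k := by simp [hk]
  have h1y : 1 ≠ y := by rintro rfl; exact hyk h1k
  have hlt := (hid 1 h1k).2 y hy hyk
  have hle1 := h2 1 (hid 1 h1k).1 h1y
  refine Finset.sup_le fun w hw => ?_
  rcases eq_or_ne w y with rfl | hne
  · omega
  · have := h2 w hw hne; omega

open Classical in
/-- The largest counter of Space Saving is at least `t / m`, and it grows only with the arrivals of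
top items and at the times when the top items are not identified. -/
lemma time_le_of_spaceSaving {k : ℕ} (hk : 1 ≤ k) (hsel : IsArgmin sel) (hm : 1 ≤ m) (t : ℕ) :
    t ≤ m * ∑ s ∈ Finset.range t, ((if x s ∈ Finset.Icc 1 k then 1 else 0) +
        if IdentifiesTop k (spaceSavingRun sel m x (s + 1)) then 0 else 1) := by
  have hsup : (spaceSavingRun sel m x t).C.sup (spaceSavingRun sel m x t).c ≤
      ∑ s ∈ Finset.range t, ((if x s ∈ Finset.Icc 1 k then 1 else 0) +
        if IdentifiesTop k (spaceSavingRun sel m x (s + 1)) then 0 else 1) := by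
    induction t with
    | zero => simp [spaceSavingRun, rapRun]
    | succ t ih =>
      rw [Finset.sum_range_succ]
      exact (sup_add_le hk hsel (card_rapRun_le hsel t) hm (x t)).trans
        (Nat.add_le_add_right ih _)
  calc t = (spaceSavingRun sel m x t).total := (total_spaceSavingRun hsel hm t).symm
    _ ≤ (spaceSavingRun sel m x t).C.card *
        (spaceSavingRun sel m x t).C.sup (spaceSavingRun sel m x t).c := by
      rw [total, ← smul_eq_mul]
      exact Finset.sum_le_card_nsmul _ _ _ fun y hy =>
        Finset.le_sup (f := (spaceSavingRun sel m x t).c) hy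
    _ ≤ _ := Nat.mul_le_mul (card_rapRun_le hsel t) hsup

end Run

/-! ### Sums along the run with negative drift -/

section Drift

variable {Ω : Type*} {X : ℕ → Ω → ℕ} {B : ℕ → Ω → Bool}

/-- The first `t` elements of the stream and the first `t` coins. -/
def history (X : ℕ → Ω → ℕ) (B : ℕ → Ω → Bool) (t : ℕ) (ω : Ω) :
    (Finset.range t → ℕ) × (Finset.range t → Bool) :=
  (fun s => X s ω, fun s => B s ω)

/-- The sequence with the given first terms and a junk continuation. -/
def extendSeq {β : Type*} [Inhabited β] {t : ℕ} (a : Finset.range t → β) (s : ℕ) : β :=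
  if h : s ∈ Finset.range t then a ⟨s, h⟩ else default

lemma eq_extendSeq_history {β : Type*} {t : ℕ} {g : (ℕ → ℕ) → (ℕ → Bool) → β}
    (hg : ∀ x x' b b', (∀ s < t, x s = x' s) → (∀ s < t, b s = b' s) → g x b = g x' b') (ω : Ω) :
    g (fun s => X s ω) (fun s => B s ω) =
      g (extendSeq (history X B t ω).1) (extendSeq (history X B t ω).2) := by
  apply hg <;> intro s hs <;> simp [extendSeq, history, hs]

variable [MeasurableSpace Ω] {μ : Measure Ω}

lemma measurable_history (hX : ∀ t, Measurable (X t)) (hB : ∀ t, Measurable (B t)) (t : ℕ) :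
    Measurable (history X B t) :=
  Measurable.prodMk (f := fun ω (s : Finset.range t) => X s ω)
    (g := fun ω (s : Finset.range t) => B s ω)
    (measurable_pi_lambda _ fun s => hX s) (measurable_pi_lambda _ fun s => hB s)

lemma measurable_of_eq_on_lt {β : Type*} [MeasurableSpace β] (hX : ∀ t, Measurable (X t))
    (hB : ∀ t, Measurable (B t)) {t : ℕ} {g : (ℕ → ℕ) → (ℕ → Bool) → β}
    (hg : ∀ x x' b b', (∀ s < t, x s = x' s) → (∀ s < t, b s = b' s) → g x b = g x' b') :
    Measurable fun ω => g (fun s => X s ω) (fun s => B s ω) := by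
  simp_rw [eq_extendSeq_history hg]
  exact (Measurable.of_discrete (f := fun h : (Finset.range t → ℕ) × (Finset.range t → Bool) =>
    g (extendSeq h.1) (extendSeq h.2))).comp (measurable_history hX hB t)

/-- The past of the stream and of the coins is independent of the present. -/
lemma indepFun_history [IsProbabilityMeasure μ] (hX : ∀ t, Measurable (X t))
    (hB : ∀ t, Measurable (B t)) (hXi : iIndepFun X μ) (hBi : iIndepFun B μ)
    (hXB : IndepFun (fun ω t => X t ω) (fun ω t => B t ω) μ) (t : ℕ) :
    IndepFun (history X B t) (fun ω => (X t ω, B t ω)) μ := by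
  have hdisj : Disjoint (Finset.range t) {t} := by simp
  have hXt := hXi.indepFun_finset (Finset.range t) {t} hdisj hX
  have hBt := hBi.indepFun_finset (Finset.range t) {t} hdisj hB
  rw [indepFun_iff_map_prod_eq_prod_map_map (measurable_history hX hB t).aemeasurable
    ((hX t).prodMk (hB t)).aemeasurable]
  refine Measure.ext_of_singleton ?_
  rintro ⟨⟨a, b⟩, ⟨x, y⟩⟩
  set A : Set (ℕ → ℕ) := {u | ∀ s : Finset.range t, u s = a s} with hA
  set A' : Set (ℕ → ℕ) := {u | u t = x} with hA'
  set C : Set (ℕ → Bool) := {u | ∀ s : Finset.range t, u s = b s} with hC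
  set C' : Set (ℕ → Bool) := {u | u t = y} with hC'
  have mA : MeasurableSet A := by
    rw [hA, Set.ofPred_forall]
    exact MeasurableSet.iInter fun s =>
      measurableSet_eq_fun (measurable_pi_apply _) measurable_const
  have mA' : MeasurableSet A' := measurableSet_eq_fun (measurable_pi_apply t) measurable_const
  have mC : MeasurableSet C := by
    rw [hC, Set.ofPred_forall]
    exact MeasurableSet.iInter fun s =>
      measurableSet_eq_fun (measurable_pi_apply _) measurable_const
  have mC' : MeasurableSet C' := measurableSet_eq_fun (measurable_pi_apply t) measurable_const
  set ξ : Ω → ℕ → ℕ := fun ω t => X t ω with hξ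
  set η : Ω → ℕ → Bool := fun ω t => B t ω with hη
  have e1 : μ (ξ ⁻¹' (A ∩ A')) = μ (ξ ⁻¹' A) * μ (ξ ⁻¹' A') := by
    have := hXt.measure_inter_preimage_eq_mul {a} {fun _ => x} (measurableSet_singleton _)
      (measurableSet_singleton _)
    convert this using 2
    · ext ω; simp [hA, hA', hξ, funext_iff]
    · congr 1; ext ω; simp [hA, hξ, funext_iff]
    · congr 1; ext ω; simp [hA', hξ, funext_iff]
  have e2 : μ (η ⁻¹' (C ∩ C')) = μ (η ⁻¹' C) * μ (η ⁻¹' C') := by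
    have := hBt.measure_inter_preimage_eq_mul {b} {fun _ => y} (measurableSet_singleton _)
      (measurableSet_singleton _)
    convert this using 2
    · ext ω; simp [hC, hC', hη, funext_iff]
    · congr 1; ext ω; simp [hC, hη, funext_iff]
    · congr 1; ext ω; simp [hC', hη, funext_iff]
  have e3 := hXB.measure_inter_preimage_eq_mul _ _ (mA.inter mA') (mC.inter mC')
  have e4 := hXB.measure_inter_preimage_eq_mul _ _ mA mC
  have e5 := hXB.measure_inter_preimage_eq_mul _ _ mA' mC'
  rw [← Set.singleton_prod_singleton, Measure.prod_prod,
    Measure.map_apply ((measurable_history hX hB t).prodMk ((hX t).prodMk (hB t)))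
      (by simp [Set.singleton_prod_singleton]),
    Measure.map_apply (measurable_history hX hB t) (measurableSet_singleton _),
    Measure.map_apply ((hX t).prodMk (hB t)) (measurableSet_singleton _)]
  have s1 : (fun ω => (history X B t ω, X t ω, B t ω)) ⁻¹' ({(a, b)} ×ˢ {(x, y)}) =
      ξ ⁻¹' (A ∩ A') ∩ η ⁻¹' (C ∩ C') := by
    ext ω
    simp only [history, Set.mem_preimage, Set.mem_prod, Set.mem_singleton_iff, Prod.mk.injEq,
      funext_iff, Set.mem_inter_iff, hA, hA', hC, hC', hξ, hη, Set.mem_ofPred_eq]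
    tauto
  have s2 : history X B t ⁻¹' {(a, b)} = ξ ⁻¹' A ∩ η ⁻¹' C := by
    ext ω
    simp only [history, Set.mem_preimage, Set.mem_singleton_iff, Prod.mk.injEq,
      funext_iff, Set.mem_inter_iff, hA, hC, hξ, hη, Set.mem_ofPred_eq]
  have s3 : (fun ω => (X t ω, B t ω)) ⁻¹' {(x, y)} = ξ ⁻¹' A' ∩ η ⁻¹' C' := by
    ext ω
    simp only [Set.mem_preimage, Set.mem_singleton_iff, Prod.mk.injEq,
      Set.mem_inter_iff, hA', hC', hξ, hη, Set.mem_ofPred_eq]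
  rw [s1, s2, s3, e3, e4, e5, e1, e2]
  ring

/-- If `Z` is independent of `Y` and the expectation of `G y Z` is at most `r` for every `y`, then
multiplying by `G Y Z` increases the expectation of a function of `Y` by a factor of at most `r`. -/
lemma lintegral_mul_le_of_indepFun [IsProbabilityMeasure μ] {β γ : Type*} [MeasurableSpace β]
    [MeasurableSpace γ] [DiscreteMeasurableSpace β] [DiscreteMeasurableSpace γ] [Countable β]
    [Countable γ] {Y : Ω → β} {Z : Ω → γ} (hY : Measurable Y) (hZ : Measurable Z)
    (h : IndepFun Y Z μ) (U : β → ENNReal) (G : β → γ → ENNReal) (r : ENNReal)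
    (hG : ∀ y, ∫⁻ ω, G y (Z ω) ∂μ ≤ r) :
    ∫⁻ ω, U (Y ω) * G (Y ω) (Z ω) ∂μ ≤ r * ∫⁻ ω, U (Y ω) ∂μ := by
  have h1 := (indepFun_iff_map_prod_eq_prod_map_map hY.aemeasurable hZ.aemeasurable).1 h
  have h2 : ∫⁻ ω, U (Y ω) * G (Y ω) (Z ω) ∂μ =
      ∫⁻ p, U p.1 * G p.1 p.2 ∂(μ.map fun ω => (Y ω, Z ω)) :=
    (lintegral_map (Measurable.of_discrete (f := fun p : β × γ => U p.1 * G p.1 p.2))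
      (hY.prodMk hZ)).symm
  rw [h2, h1, lintegral_prod _ (Measurable.of_discrete).aemeasurable]
  calc ∫⁻ y, ∫⁻ z, U y * G y z ∂μ.map Z ∂μ.map Y ≤ ∫⁻ y, U y * r ∂μ.map Y := by
        refine lintegral_mono fun y => ?_
        rw [lintegral_const_mul _ Measurable.of_discrete,
          lintegral_map (Measurable.of_discrete (f := G y)) hZ]
        gcongr
        exact hG y
    _ = r * ∫⁻ ω, U (Y ω) ∂μ := by
        rw [lintegral_mul_const _ Measurable.of_discrete,
          lintegral_map (Measurable.of_discrete (f := U)) hY, mul_comm]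

/-- If a bounded function `f` of the table, the arriving item and the coin has a mean below `-δ`,
whatever the table is, then its sum along the run is eventually negative. The exponential moments
of the sums decay geometrically, so that the Borel–Cantelli lemma applies. -/
theorem ae_eventually_sum_nonpos [IsProbabilityMeasure μ] (hX : ∀ t, Measurable (X t))
    (hB : ∀ t, Measurable (B t)) (hXi : iIndepFun X μ) (hBi : iIndepFun B μ)
    (hXB : IndepFun (fun ω t => X t ω) (fun ω t => B t ω) μ) {sel : CounterTable → ℕ} {m : ℕ}
    (hsel : IsArgmin sel) {f : CounterTable → ℕ → Bool → ℝ} {K δ : ℝ} (hδ : 0 < δ)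
    (hK : ∀ T x b, |f T x b| ≤ K)
    (hf : ∀ t T, T.C.card ≤ m → ∫ ω, f T (X t ω) (B t ω) ∂μ ≤ -δ) :
    ∀ᵐ ω ∂μ, ∀ᶠ t in atTop, ∑ s ∈ Finset.range t,
      f (rapRun sel m (fun s => X s ω) (fun s => B s ω) s) (X s ω) (B s ω) ≤ 0 := by
  have hint : ∀ t T, Integrable (fun ω => f T (X t ω) (B t ω)) μ := fun t T => by
    refine Integrable.of_bound (C := K) ?_ (ae_of_all _ fun ω => hK _ _ _)
    exact ((Measurable.of_discrete (f := fun p : ℕ × Bool => f T p.1 p.2)).comp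
      ((hX t).prodMk (hB t))).aestronglyMeasurable
  have hKδ : δ ≤ K := by
    have h1 := hf 0 ⟨∅, fun _ => 0⟩ (by simp)
    have h2 : -K ≤ ∫ ω, f ⟨∅, fun _ => 0⟩ (X 0 ω) (B 0 ω) ∂μ := by
      have := integral_mono (μ := μ) (integrable_const (-K)) (hint 0 ⟨∅, fun _ => 0⟩)
        (fun ω => (abs_le.1 (hK _ _ _)).1)
      simpa using this
    linarith
  have hK0 : 0 < K := hδ.trans_le hKδ
  set θ : ℝ := δ / (2 * K ^ 2) with hθ
  have hθ0 : 0 < θ := by positivity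
  have hθK : θ * K ≤ 1 := by
    rw [hθ, div_mul_eq_mul_div, div_le_one (by positivity)]
    nlinarith
  set r : ℝ := 1 - δ ^ 2 / (4 * K ^ 2) with hr
  have hr1 : r < 1 := by
    have : 0 < δ ^ 2 / (4 * K ^ 2) := by positivity
    linarith
  have hθr : 1 - θ * δ + θ ^ 2 * K ^ 2 = r := by
    rw [hθ, hr]; field_simp; ring
  have hexp : ∀ t T, T.C.card ≤ m →
      ∫⁻ ω, ENNReal.ofReal (Real.exp (θ * f T (X t ω) (B t ω))) ∂μ ≤ ENNReal.ofReal r := by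
    intro t T hT
    have hle : ∀ ω, Real.exp (θ * f T (X t ω) (B t ω)) ≤
        1 + θ * f T (X t ω) (B t ω) + θ ^ 2 * K ^ 2 := by
      intro ω
      have h1 : |θ * f T (X t ω) (B t ω)| ≤ θ * K := by
        rw [abs_mul, abs_of_pos hθ0]
        exact mul_le_mul_of_nonneg_left (hK _ _ _) hθ0.le
      have h2 := (abs_le.1 (Real.abs_exp_sub_one_sub_id_le (h1.trans hθK))).2
      have h3 : (θ * f T (X t ω) (B t ω)) ^ 2 ≤ (θ * K) ^ 2 :=
        sq_le_sq' (abs_le.1 h1).1 (abs_le.1 h1).2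
      nlinarith
    have hi : Integrable (fun ω => 1 + θ * f T (X t ω) (B t ω) + θ ^ 2 * K ^ 2) μ :=
      ((integrable_const _).add ((hint t T).const_mul θ)).add (integrable_const _)
    calc ∫⁻ ω, ENNReal.ofReal (Real.exp (θ * f T (X t ω) (B t ω))) ∂μ
        ≤ ∫⁻ ω, ENNReal.ofReal (1 + θ * f T (X t ω) (B t ω) + θ ^ 2 * K ^ 2) ∂μ :=
          lintegral_mono fun ω => ENNReal.ofReal_le_ofReal (hle ω)
      _ = ENNReal.ofReal (∫ ω, (1 + θ * f T (X t ω) (B t ω) + θ ^ 2 * K ^ 2) ∂μ) :=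
          (ofReal_integral_eq_lintegral_ofReal hi
            (ae_of_all _ fun ω => (Real.exp_pos _).le.trans (hle ω))).symm
      _ ≤ ENNReal.ofReal r := by
          refine ENNReal.ofReal_le_ofReal ?_
          have h1 : Integrable (fun ω => 1 + θ * f T (X t ω) (B t ω)) μ :=
            (integrable_const _).add ((hint t T).const_mul θ)
          rw [integral_add h1 (integrable_const _),
            integral_add (integrable_const _) ((hint t T).const_mul θ), integral_const_mul]
          simp only [integral_const, probReal_univ, smul_eq_mul, one_mul]
          nlinarith [hf t T hT]
  -- the partial sums along the run, as a function of the two sequences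
  set F : ℕ → (ℕ → ℕ) → (ℕ → Bool) → ℝ := fun t x b =>
    ∑ s ∈ Finset.range t, f (rapRun sel m x b s) (x s) (b s) with hF
  have hFc : ∀ t x x' b b', (∀ s < t, x s = x' s) → (∀ s < t, b s = b' s) →
      F t x b = F t x' b' := by
    intro t x x' b b' hx hb
    refine Finset.sum_congr rfl fun s hs => ?_
    have hs := Finset.mem_range.1 hs
    rw [rapRun_congr (fun u hu => hx u (hu.trans hs)) (fun u hu => hb u (hu.trans hs)),
      hx s hs, hb s hs]
  have hE : ∀ t, ∫⁻ ω, ENNReal.ofReal (Real.exp (θ * F t (fun s => X s ω) (fun s => B s ω))) ∂μ ≤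
      ENNReal.ofReal r ^ t := by
    intro t
    induction t with
    | zero => simp [hF]
    | succ t ih =>
      have h1 := lintegral_mul_le_of_indepFun (measurable_history hX hB t)
        ((hX t).prodMk (hB t)) (indepFun_history hX hB hXi hBi hXB t)
        (fun h => ENNReal.ofReal (Real.exp (θ * F t (extendSeq h.1) (extendSeq h.2))))
        (fun h z => ENNReal.ofReal
          (Real.exp (θ * f (rapRun sel m (extendSeq h.1) (extendSeq h.2) t) z.1 z.2)))
        (ENNReal.ofReal r) (fun h => hexp t _ (card_rapRun_le hsel t))
      have h2 : ∀ ω, F t (fun s => X s ω) (fun s => B s ω) = _ :=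
        eq_extendSeq_history (hFc t)
      have h3 : ∀ ω, rapRun sel m (fun s => X s ω) (fun s => B s ω) t = _ :=
        eq_extendSeq_history (fun x x' b b' hx hb => rapRun_congr hx hb)
      simp only [← h2, ← h3] at h1
      rw [pow_succ']
      refine le_trans (le_of_eq ?_) (h1.trans (by gcongr))
      refine lintegral_congr fun ω => ?_
      rw [← ENNReal.ofReal_mul (Real.exp_pos _).le, ← Real.exp_add, ← mul_add]
      simp only [hF, Finset.sum_range_succ]
  have hBC : ∑' t, μ {ω | 0 < F t (fun s => X s ω) (fun s => B s ω)} ≠ ⊤ := by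
    have hle : ∀ t, μ {ω | 0 < F t (fun s => X s ω) (fun s => B s ω)} ≤ ENNReal.ofReal r ^ t := by
      intro t
      refine le_trans ?_ (hE t)
      have hmeas : Measurable fun ω =>
          ENNReal.ofReal (Real.exp (θ * F t (fun s => X s ω) (fun s => B s ω))) :=
        ((measurable_of_eq_on_lt hX hB (hFc t)).const_mul θ).exp.ennreal_ofReal
      have h1 := mul_meas_ge_le_lintegral (μ := μ) hmeas 1
      rw [one_mul] at h1
      refine (measure_mono fun ω hω => ?_).trans h1
      have : (0 : ℝ) ≤ θ * F t (fun s => X s ω) (fun s => B s ω) :=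
        mul_nonneg hθ0.le (le_of_lt hω)
      simpa using this
    refine ne_top_of_le_ne_top ?_ (ENNReal.tsum_le_tsum hle)
    rw [ENNReal.tsum_geometric]
    refine ENNReal.inv_ne_top.2 (tsub_pos_of_lt ?_).ne'
    rw [← ENNReal.ofReal_one]
    exact (ENNReal.ofReal_lt_ofReal_iff one_pos).2 hr1
  filter_upwards [ae_eventually_notMem hBC] with ω hω
  filter_upwards [hω] with t ht
  exact not_lt.1 ht

/-- The strong law of large numbers for the number of occurrences of an item. -/
theorem ae_tendsto_arrivals [IsProbabilityMeasure μ] (hX : ∀ t, Measurable (X t))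
    (hXi : iIndepFun X μ) {p : ℕ → ℝ} (hp : ∀ t i, μ.real {ω | X t ω = i} = p i) (j : ℕ) :
    ∀ᵐ ω ∂μ, Tendsto (fun t : ℕ => (arrivals (fun s => X s ω) j t : ℝ) / t) atTop (𝓝 (p j)) := by
  set g : ℕ → ℝ := fun x => if x = j then 1 else 0 with hg
  have hgm : Measurable g := Measurable.of_discrete
  have hset : ∀ t, MeasurableSet {ω | X t ω = j} := fun t => hX t (measurableSet_singleton j)
  have hind : ∀ t, (fun ω => g (X t ω)) = Set.indicator {ω | X t ω = j} 1 := fun t => by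
    ext ω; simp [hg, Set.indicator_apply]
  have hident : ∀ t, IdentDistrib (fun ω => g (X t ω)) (fun ω => g (X 0 ω)) μ μ := by
    intro t
    refine IdentDistrib.comp (u := g) ⟨(hX t).aemeasurable, (hX 0).aemeasurable, ?_⟩ hgm
    refine Measure.ext_of_singleton fun i => ?_
    rw [Measure.map_apply (hX t) (measurableSet_singleton i),
      Measure.map_apply (hX 0) (measurableSet_singleton i)]
    exact (measureReal_eq_measureReal_iff).1 ((hp t i).trans (hp 0 i).symm)
  have h := strong_law_ae_real (μ := μ) (fun t ω => g (X t ω))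
    (by rw [hind 0]; exact (integrable_const (1 : ℝ)).indicator (hset 0))
    (fun s t hst => (hXi.indepFun hst).comp hgm hgm) hident
  have hmean : ∫ ω, g (X 0 ω) ∂μ = p j := by
    rw [hind 0, integral_indicator_one (hset 0), hp 0]
  rw [hmean] at h
  filter_upwards [h] with ω hω
  refine hω.congr fun t => ?_
  simp [arrivals, hg]

end Drift

/-! ### The Lyapunov function -/

section Lyapunov

open CounterTable

variable {sel : CounterTable → ℕ} {T : CounterTable} {m i x y z : ℕ} {r β P κ : ℝ}

/-- The item `i` is monitored and its counter lies above the minimum, so that `i` cannot be evicted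
by the next arrival. -/
def IsSafe (sel : CounterTable → ℕ) (i : ℕ) (T : CounterTable) : Prop :=
  i ∈ T.C ∧ T.c (sel T) < T.c i

open Classical in
/-- A heuristic bound for the chance that the item `i` ceases to be safe. The exponent of `1 / 2` is
the number of levels that the minimum can climb while `i` remains safe, and `r ^ minCount` stands
for the chance that the minimum climbs before the next arrival of `i`. -/
noncomputable def risk (sel : CounterTable → ℕ) (i : ℕ) (r : ℝ) (T : CounterTable) : ℝ :=
  if IsSafe sel i T then (1 / 2) ^ (T.c i - T.c (sel T) - 1) * r ^ minCount sel T else 1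

/-- The minimal counter value with an interpolation between the levels that grows by
`r ^ (minCount - 1)` when a minimal counter is incremented. -/
noncomputable def smoothLevel (sel : CounterTable → ℕ) (r : ℝ) (T : CounterTable) : ℝ :=
  ((T.c (sel T) : ℝ) - 1 + r ^ minCount sel T) / (1 - r)

lemma risk_of_not_isSafe (h : ¬ IsSafe sel i T) : risk sel i r T = 1 := if_neg h

lemma risk_of_isSafe (h : IsSafe sel i T) :
    risk sel i r T = (1 / 2) ^ (T.c i - T.c (sel T) - 1) * r ^ minCount sel T := if_pos h

lemma risk_nonneg (hr : 0 < r) : 0 ≤ risk sel i r T := by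
  unfold risk; split_ifs <;> positivity

lemma risk_le_one (hr : 0 < r) (hr1 : r < 1) : risk sel i r T ≤ 1 := by
  unfold risk
  split_ifs
  · exact mul_le_one₀ (pow_le_one₀ (by norm_num) (by norm_num)) (by positivity)
      (pow_le_one₀ hr.le hr1.le)
  · exact le_rfl

lemma ne_of_isSafe_of_eq (hs : IsSafe sel i T) (heq : T.c z = T.c (sel T)) : i ≠ z := by
  rintro rfl
  exact absurd hs.2 (by rw [heq]; exact lt_irrefl _)

/-- Incrementing a counter above the minimum: that of `i` halves the risk, others do not matter. -/
lemma risk_bump_of_gt (hsel : IsArgmin sel) (hz : z ∈ T.C) (hgt : T.c (sel T) < T.c z) :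
    risk sel i r (T.bump z z) = if z = i then risk sel i r T / 2 else risk sel i r T := by
  obtain ⟨h1, h2, -⟩ := bump_of_gt hsel hz (Finset.notMem_erase z T.C) hgt
  split_ifs with h
  · subst h
    have hs : IsSafe sel z T := ⟨hz, hgt⟩
    have hs' : IsSafe sel z (T.bump z z) :=
      ⟨mem_bump.2 (.inl rfl), by rw [h1, bump_c_self]; omega⟩
    rw [risk_of_isSafe hs, risk_of_isSafe hs', h1, h2, bump_c_self,
      show T.c z + 1 - T.c (sel T) - 1 = T.c z - T.c (sel T) - 1 + 1 by omega, pow_succ]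
    ring
  · have hmem : i ∈ (T.bump z z).C ↔ i ∈ T.C := by rw [mem_bump]; grind
    have hc : (T.bump z z).c i = T.c i := bump_c_of_ne (Ne.symm h)
    by_cases hs : IsSafe sel i T
    · have hs' : IsSafe sel i (T.bump z z) := ⟨hmem.2 hs.1, by rw [h1, hc]; exact hs.2⟩
      rw [risk_of_isSafe hs, risk_of_isSafe hs', h1, h2, hc]
    · have hs' : ¬ IsSafe sel i (T.bump z z) := fun h => hs
        ⟨hmem.1 h.1, by have := h.2; rwa [h1, hc] at this⟩
      rw [risk_of_not_isSafe hs, risk_of_not_isSafe hs']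

lemma isSafe_bump_mem (hs : IsSafe sel i T) (hy : y ∉ T.C.erase z)
    (heq : T.c z = T.c (sel T)) : i ∈ (T.bump z y).C ∧ (T.bump z y).c i = T.c i := by
  have hiz := ne_of_isSafe_of_eq hs heq
  have hiy : i ≠ y := by rintro rfl; exact hy (Finset.mem_erase.2 ⟨hiz, hs.1⟩)
  exact ⟨mem_bump.2 (.inr ⟨hiz, hs.1⟩), bump_c_of_ne hiy⟩

/-- Incrementing a minimal counter divides the risk by at most `r`. The exception is a new level at
which fewer than half of the counters are minimal; it is paid for by the loss of excess. -/
lemma risk_add_excess_bump_le (hsel : IsArgmin sel) (hr : 0 < r) (hr1 : r < 1) (hm : 1 ≤ m)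
    (hrm : ∀ n, m ≤ 2 * n → 2 * r ^ n ≤ 1) (hT : T.C.card = m)
    (hz : z ∈ T.C) (hy : y ∉ T.C.erase z) (heq : T.c z = T.c (sel T)) (hs : IsSafe sel i T) :
    risk sel i r (T.bump z y) + 2 / m * excess sel (T.bump z y) ≤
      risk sel i r T / r + 2 / m * excess sel T := by
  have hm' : (0 : ℝ) < m := by exact_mod_cast hm
  obtain ⟨hmem, hc⟩ := isSafe_bump_mem hs hy heq
  have hn := one_le_minCount hsel ⟨z, hz⟩
  rcases hn.lt_or_eq.symm.imp_left Eq.symm with hn1 | hn1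
  · obtain ⟨h1, h2⟩ := bump_of_unique hsel hz hy heq hn1
    have hn' : minCount sel (T.bump z y) ≤ m :=
      minCount_le_card.trans (by rw [card_bump hz hy, hT])
    have h2' : (excess sel (T.bump z y) : ℝ) + m = excess sel T + minCount sel (T.bump z y) := by
      rw [← hT]; exact_mod_cast h2
    have hlt := hs.2
    have hR : risk sel i r T / r = (1 / 2) ^ (T.c i - T.c (sel T) - 1) := by
      rw [risk_of_isSafe hs, hn1]; field_simp
    set n' := minCount sel (T.bump z y) with hn'def
    have hex : 2 / (m : ℝ) * excess sel (T.bump z y) =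
        2 / m * excess sel T - 2 / m * (m - n') := by
      rw [← mul_sub]; congr 1; linarith
    rw [hR, hex]
    have hpos : 0 ≤ 2 / (m : ℝ) * (m - n') := by
      have : (n' : ℝ) ≤ m := by exact_mod_cast hn'
      have : (0 : ℝ) ≤ m - n' := by linarith
      positivity
    suffices h : risk sel i r (T.bump z y) ≤
        (1 / 2) ^ (T.c i - T.c (sel T) - 1) + 2 / (m : ℝ) * (m - n') by linarith
    by_cases hg : T.c i = T.c (sel T) + 1
    · refine (risk_le_one hr hr1).trans ?_
      rw [hg]; simpa using hpos
    · have hs' : IsSafe sel i (T.bump z y) := ⟨hmem, by rw [h1, hc]; omega⟩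
      by_cases hhalf : m ≤ 2 * n'
      · rw [risk_of_isSafe hs', h1, hc, ← hn'def,
          show T.c i - T.c (sel T) - 1 = T.c i - (T.c (sel T) + 1) - 1 + 1 by omega, pow_succ]
        have := hrm n' hhalf
        have h3 : (0 : ℝ) < (1 / 2) ^ (T.c i - (T.c (sel T) + 1) - 1) := by positivity
        nlinarith
      · refine (risk_le_one hr hr1).trans ?_
        have h3 : (2 : ℝ) * n' ≤ m := by exact_mod_cast (not_le.1 hhalf).le
        have h4 : 1 ≤ 2 / (m : ℝ) * (m - n') := by
          rw [div_mul_eq_mul_div, le_div_iff₀ hm']; linarith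
        have h5 : (0 : ℝ) < (1 / 2) ^ (T.c i - T.c (sel T) - 1) := by positivity
        linarith
  · obtain ⟨h1, h2, h3⟩ := bump_of_eq hsel hz hy heq hn1
    have hs' : IsSafe sel i (T.bump z y) := ⟨hmem, by rw [h1, hc]; exact hs.2⟩
    rw [h3, risk_of_isSafe hs, risk_of_isSafe hs', h1, hc, ← h2, pow_succ]
    field_simp
    exact le_rfl

/-- When an unsafe item gets the counter after the minimum, its risk becomes small. -/
lemma risk_bump_self_le (hsel : IsArgmin sel) (hr : 0 < r) (hr1 : r < 1)
    (hz : z ∈ T.C) (hy : y ∉ T.C.erase z) (heq : T.c z = T.c (sel T)) :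
    risk sel y r (T.bump z y) ≤ r ^ (minCount sel T - 1) := by
  have hn := one_le_minCount hsel ⟨z, hz⟩
  rcases hn.lt_or_eq.symm.imp_left Eq.symm with hn1 | hn1
  · rw [hn1]; simpa using risk_le_one hr hr1
  · obtain ⟨h1, h2, h3⟩ := bump_of_eq hsel hz hy heq hn1
    have hs' : IsSafe sel y (T.bump z y) :=
      ⟨mem_bump.2 (.inl rfl), by rw [h1, bump_c_self, heq]; omega⟩
    rw [risk_of_isSafe hs', h1, bump_c_self, heq, ← h2]
    simp

lemma excess_bump_le (hsel : IsArgmin sel) (hz : z ∈ T.C) (hy : y ∉ T.C.erase z)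
    (heq : T.c z = T.c (sel T)) : excess sel (T.bump z y) ≤ excess sel T := by
  have hn := one_le_minCount hsel ⟨z, hz⟩
  rcases hn.lt_or_eq.symm.imp_left Eq.symm with hn1 | hn1
  · have h1 := (bump_of_unique hsel hz hy heq hn1).2
    have h2 : minCount sel (T.bump z y) ≤ T.C.card := by
      rw [← card_bump hz hy]; exact minCount_le_card
    omega
  · exact (bump_of_eq hsel hz hy heq hn1).2.2.le

lemma smoothLevel_bump_of_eq (hsel : IsArgmin sel) (hr : 0 < r) (hr1 : r < 1)
    (hz : z ∈ T.C) (hy : y ∉ T.C.erase z) (heq : T.c z = T.c (sel T)) :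
    smoothLevel sel r T + r ^ (minCount sel T - 1) ≤ smoothLevel sel r (T.bump z y) := by
  have hr' : 0 < 1 - r := by linarith
  have hn := one_le_minCount hsel ⟨z, hz⟩
  unfold smoothLevel
  rw [div_add' _ _ _ hr'.ne', div_le_div_iff_of_pos_right hr']
  rcases hn.lt_or_eq.symm.imp_left Eq.symm with hn1 | hn1
  · rw [(bump_of_unique hsel hz hy heq hn1).1, hn1]
    have : (0 : ℝ) < r ^ minCount sel (T.bump z y) := by positivity
    push_cast
    simp only [pow_one, pow_zero, one_mul]
    linarith
  · obtain ⟨h1, h2, -⟩ := bump_of_eq hsel hz hy heq hn1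
    rw [h1, ← h2, Nat.add_sub_cancel, pow_succ]
    linarith

/-- The Lyapunov function: for suitable parameters its expected change is negative at every full
table, and it is nonnegative while the item `i` is not monitored. A drop of the risk by
`1 - r ^ (minCount - 1)` at the admission of `i` is made up to `1` by the growth of the smooth
level, the excess pays for the levels that start with few minimal counters, and the total, which
has small drift since `m` is large, dominates the negative terms if `i` is not monitored. -/
noncomputable def lyapunov (sel : CounterTable → ℕ) (m i : ℕ) (r β P κ : ℝ) (T : CounterTable) : ℝ :=
  (risk sel i r T + 2 / m * excess sel T - β * smoothLevel sel r T) / P - estimate sel m i T +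
    κ / m * T.total

open Classical in
/-- A bounded upper estimate of the change of the Lyapunov function, as a linear combination of the
indicators of four events about the arriving item `x` and the coin `b`. -/
noncomputable def lyapunovGain (sel : CounterTable → ℕ) (m i : ℕ) (r β P κ : ℝ) (T : CounterTable)
    (x : ℕ) (b : Bool) : ℝ :=
  (if IsSafe sel i T then -(risk sel i r T / 2 / P) - 1 else 0) * (if x = i then 1 else 0) +
  ((if IsSafe sel i T then (1 / r - 1) * risk sel i r T else 0) / P + 2 / m / P + κ / m) *
    (if x ∈ T.C then 1 else 0) +
  (if IsSafe sel i T then 0 else -((1 - r ^ (minCount sel T - 1)) / P)) *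
    (if x = i ∧ b = true then 1 else 0) +
  ((if IsSafe sel i T then (1 / r - 1) * risk sel i r T else 0) / P -
      β * r ^ (minCount sel T - 1) / P + κ / m) * (if x ∉ T.C ∧ b = true then 1 else 0)

open Classical in
lemma lyapunov_add_le (hsel : IsArgmin sel) (hr : 0 < r) (hr1 : r < 1) (hm : 1 ≤ m)
    (hrm : ∀ n, m ≤ 2 * n → 2 * r ^ n ≤ 1) (hβ : 0 ≤ β) (hP : 0 < P) (hT : T.C.card = m)
    (x : ℕ) (b : Bool) :
    lyapunov sel m i r β P κ (T.add sel m b x) ≤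
      lyapunov sel m i r β P κ T + lyapunovGain sel m i r β P κ T x b := by
  have hm' : (0 : ℝ) < m := by exact_mod_cast hm
  have hest := estimate_add (a := b) (x := x) hsel hT.le hm i
  have hV0 : 0 ≤ risk sel i r T := risk_nonneg hr
  have hinv : 0 < 1 / r - 1 := by rw [sub_pos, lt_div_iff₀ hr]; linarith
  have hgood : risk sel i r T / r = risk sel i r T + (1 / r - 1) * risk sel i r T := by
    field_simp; ring
  have hw0 : (0 : ℝ) < r ^ (minCount sel T - 1) := by positivity
  have hw1 : r ^ (minCount sel T - 1) ≤ 1 := pow_le_one₀ hr.le hr1.le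
  have hm2 : 0 < 2 / (m : ℝ) := by positivity
  have hRV : 0 ≤ (1 / r - 1) * risk sel i r T := mul_nonneg hinv.le hV0
  -- it suffices to bound the change of the part that is divided by `P`
  have main : ∀ (T' : CounterTable) (g e s : ℝ),
      risk sel i r T' + 2 / m * excess sel T' - β * smoothLevel sel r T' ≤
        risk sel i r T + 2 / m * excess sel T - β * smoothLevel sel r T + g →
      (estimate sel m i T : ℝ) + e ≤ estimate sel m i T' → (T'.total : ℝ) = T.total + s →
      lyapunov sel m i r β P κ T' ≤ lyapunov sel m i r β P κ T + (g / P - e + κ / m * s) := by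
    intro T' g e s h1 h2 h3
    unfold lyapunov
    rw [h3]
    have := div_le_div_of_nonneg_right h1 hP.le
    rw [add_div] at this
    linarith
  rcases add_cases hsel hT.le hm b x with
    ⟨hx, e⟩ | ⟨hx, h', -⟩ | ⟨hx, -, hb, hs, e⟩ | ⟨hx, -, hb, e⟩
  · have hxe : x ∉ T.C.erase x := Finset.notMem_erase x T.C
    rw [e] at hest ⊢
    have htot : ((T.bump x x).total : ℝ) = T.total + 1 := by exact_mod_cast total_bump hx hxe
    rcases ((hsel T ⟨x, hx⟩).2 x hx).lt_or_eq with hgt | heq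
    · obtain ⟨h1, h2, h3⟩ := bump_of_gt hsel hx hxe hgt
      have hQ : smoothLevel sel r (T.bump x x) = smoothLevel sel r T := by
        unfold smoothLevel; rw [h1, h2]
      have hV := risk_bump_of_gt (i := i) (r := r) hsel hx hgt
      by_cases hxi : x = i
      · subst hxi
        have hsafe : IsSafe sel x T := ⟨hx, hgt⟩
        rw [if_pos rfl] at hV
        rw [if_pos (by simp [hx])] at hest
        refine (main _ (-(risk sel x r T / 2) + 2 / m) 1 1 ?_ (by exact_mod_cast hest) htot).trans ?_
        · rw [hV, hQ, h3]; push_cast; linarith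
        · simp only [lyapunovGain, hsafe, hx, if_true, not_true, false_and, if_false]
          have h5 : 0 ≤ (1 / r - 1) * risk sel x r T / P := div_nonneg hRV hP.le
          rw [add_div]
          simp only [neg_div]
          linarith
      · rw [if_neg hxi] at hV
        refine (main _ (2 / m) 0 1 ?_ ?_ htot).trans ?_
        · rw [hV, hQ, h3]; push_cast; linarith
        · rw [add_zero]; exact_mod_cast (Nat.le_add_right _ _).trans hest
        · simp only [lyapunovGain, hx, hxi, if_true, not_true, false_and, if_false]
          have h5 : 0 ≤ (if IsSafe sel i T then (1 / r - 1) * risk sel i r T else 0) / P := by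
            split_ifs
            · exact div_nonneg hRV hP.le
            · simp
          linarith
    · have heq := heq.symm
      have hQ := smoothLevel_bump_of_eq hsel hr hr1 hx hxe heq
      have hQ' : β * smoothLevel sel r T ≤ β * smoothLevel sel r (T.bump x x) :=
        mul_le_mul_of_nonneg_left (by linarith) hβ
      by_cases hsafe : IsSafe sel i T
      · have hxi : x ≠ i := (ne_of_isSafe_of_eq hsafe heq).symm
        have hV := risk_add_excess_bump_le hsel hr hr1 hm hrm hT hx hxe heq hsafe
        refine (main _ ((1 / r - 1) * risk sel i r T) 0 1 ?_ ?_ htot).trans ?_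
        · linarith
        · rw [add_zero]; exact_mod_cast (Nat.le_add_right _ _).trans hest
        · simp only [lyapunovGain, hx, hxi, hsafe, if_true, not_true, false_and, if_false]
          have : 0 < 2 / (m : ℝ) / P := by positivity
          linarith
      · have hR : (excess sel (T.bump x x) : ℝ) ≤ excess sel T := by
          exact_mod_cast excess_bump_le hsel hx hxe heq
        have hR' := mul_le_mul_of_nonneg_left hR hm2.le
        have h1 := risk_of_not_isSafe (r := r) hsafe
        by_cases hxi : x = i
        · subst hxi
          have hV := risk_bump_self_le (r := r) hsel hr hr1 hx hxe heq
          have h4 : 0 < 2 / (m : ℝ) / P := by positivity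
          refine (main _ (if b = true then -(1 - r ^ (minCount sel T - 1)) else 0) 0 1 ?_ ?_
            htot).trans ?_
          · split_ifs <;> linarith
          · rw [add_zero]; exact_mod_cast (Nat.le_add_right _ _).trans hest
          · simp only [lyapunovGain, hx, hsafe, if_true, not_true, false_and, if_false, true_and,
              zero_div]
            split_ifs
            · rw [neg_div]; linarith
            · rw [zero_div]; linarith
        · have hV : risk sel i r (T.bump x x) ≤ 1 := risk_le_one hr hr1
          refine (main _ 0 0 1 ?_ ?_ htot).trans ?_
          · linarith
          · rw [add_zero]; exact_mod_cast (Nat.le_add_right _ _).trans hest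
          · simp only [lyapunovGain, hx, hxi, hsafe, if_true, not_true, false_and, if_false]
            have h4 : 0 < 2 / (m : ℝ) / P := by positivity
            simp only [zero_div]
            linarith
  · omega
  · have hxe : x ∉ T.C.erase (sel T) := fun H => hx (Finset.mem_of_mem_erase H)
    rw [e] at hest ⊢
    have htot : ((T.bump (sel T) x).total : ℝ) = T.total + 1 := by
      exact_mod_cast total_bump hs hxe
    have hQ := smoothLevel_bump_of_eq hsel hr hr1 hs hxe rfl
    have hQ' := mul_le_mul_of_nonneg_left hQ hβ
    rw [mul_add] at hQ'
    have hest' : (estimate sel m i T : ℝ) + 0 ≤ estimate sel m i (T.bump (sel T) x) := by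
      rw [add_zero]; exact_mod_cast (Nat.le_add_right _ _).trans hest
    by_cases hsafe : IsSafe sel i T
    · have hxi : x ≠ i := by rintro rfl; exact hx hsafe.1
      have hV := risk_add_excess_bump_le hsel hr hr1 hm hrm hT hs hxe rfl hsafe
      refine (main _ ((1 / r - 1) * risk sel i r T - β * r ^ (minCount sel T - 1)) 0 1
        (by linarith) hest' htot).trans ?_
      simp only [lyapunovGain, hx, hxi, hsafe, hb, if_true, not_false_eq_true, true_and, false_and,
        if_false, sub_div]
      linarith
    · have hR : (excess sel (T.bump (sel T) x) : ℝ) ≤ excess sel T := by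
        exact_mod_cast excess_bump_le hsel hs hxe rfl
      have hR' := mul_le_mul_of_nonneg_left hR hm2.le
      have h1 := risk_of_not_isSafe (r := r) hsafe
      by_cases hxi : x = i
      · subst hxi
        have hV := risk_bump_self_le (r := r) hsel hr hr1 hs hxe rfl
        refine (main _ (-(1 - r ^ (minCount sel T - 1)) - β * r ^ (minCount sel T - 1)) 0 1
          (by linarith) hest' htot).trans ?_
        simp only [lyapunovGain, hx, hsafe, hb, if_true, not_false_eq_true, true_and, if_false,
          sub_div, neg_div, zero_div]
        linarith
      · have hV : risk sel i r (T.bump (sel T) x) ≤ 1 := risk_le_one hr hr1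
        refine (main _ (-(β * r ^ (minCount sel T - 1))) 0 1
          (by linarith) hest' htot).trans ?_
        simp only [lyapunovGain, hx, hxi, hsafe, hb, if_true, not_false_eq_true, true_and,
          false_and, if_false, neg_div, zero_div]
        linarith
  · rw [e]
    have : lyapunovGain sel m i r β P κ T x b = 0 := by
      by_cases hsafe : IsSafe sel i T
      · have hxi : x ≠ i := by rintro rfl; exact hx hsafe.1
        simp [lyapunovGain, hx, hxi, hb]
      · simp [lyapunovGain, hx, hsafe, hb]
    rw [this, add_zero]

/-- While `i` is not monitored, the term with the sum of the counters dominates the others. -/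
lemma lyapunov_nonneg (hsel : IsArgmin sel) (hr : 0 < r) (hr1 : r < 1) (hm : 1 ≤ m)
    (hβ : 0 ≤ β) (hP : 0 < P) (hκ : β / (1 - r) / P + 1 ≤ κ) (hT : T.C.card = m)
    (hi : i ∉ T.C) : 0 ≤ lyapunov sel m i r β P κ T := by
  have hm' : (0 : ℝ) < m := by exact_mod_cast hm
  have hr' : 0 < 1 - r := by linarith
  have hV : 0 ≤ risk sel i r T := risk_nonneg hr
  have hQ : smoothLevel sel r T ≤ T.c (sel T) / (1 - r) := by
    unfold smoothLevel
    refine div_le_div_of_nonneg_right ?_ hr'.le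
    have : r ^ minCount sel T ≤ 1 := pow_le_one₀ hr.le hr1.le
    linarith
  have htot : (m : ℝ) * T.c (sel T) ≤ T.total := by
    have := mul_level_le_total hsel hT.le
    rw [level_of_full hT] at this
    exact_mod_cast this
  have hκ0 : 0 ≤ κ := le_trans (by positivity) hκ
  have h1 : κ * T.c (sel T) ≤ κ / m * T.total := by
    calc κ * T.c (sel T) = κ / m * (m * T.c (sel T)) := by field_simp
      _ ≤ _ := mul_le_mul_of_nonneg_left htot (by positivity)
  have h2 : -(β / (1 - r) / P * T.c (sel T)) ≤
      (risk sel i r T + 2 / m * excess sel T - β * smoothLevel sel r T) / P := by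
    have : -(β * (T.c (sel T) / (1 - r))) ≤
        risk sel i r T + 2 / m * excess sel T - β * smoothLevel sel r T := by
      have h3 := mul_le_mul_of_nonneg_left hQ hβ
      have : (0 : ℝ) ≤ 2 / m * excess sel T := by positivity
      linarith
    calc -(β / (1 - r) / P * T.c (sel T)) = -(β * (T.c (sel T) / (1 - r))) / P := by
          field_simp
      _ ≤ _ := div_le_div_of_nonneg_right this hP.le
  have h3 : (β / (1 - r) / P + 1) * T.c (sel T) ≤ κ * T.c (sel T) :=
    mul_le_mul_of_nonneg_right hκ (Nat.cast_nonneg _)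
  unfold lyapunov
  rw [estimate, if_neg hi, level_of_full hT]
  linarith

end Lyapunov

/-! ### The drift of the Lyapunov function and of the sum of the counters -/

section Recurrence

open CounterTable

variable {Ω : Type*} [MeasurableSpace Ω] {μ : Measure Ω}

/-- The mean of a combination of the four events that determine the effect of an arrival. -/
lemma integral_arrival_events [IsProbabilityMeasure μ] {ξ : Ω → ℕ} {η : Ω → Bool}
    (hξ : Measurable ξ) (hη : Measurable η) (h : IndepFun ξ η μ) (A B C D : ℝ) (i : ℕ)
    (S : Finset ℕ) :
    ∫ ω, (A * (if ξ ω = i then 1 else 0) + B * (if ξ ω ∈ S then 1 else 0) +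
      C * (if ξ ω = i ∧ η ω = true then 1 else 0) +
      D * (if ξ ω ∉ S ∧ η ω = true then 1 else 0)) ∂μ =
    A * μ.real {ω | ξ ω = i} + B * μ.real {ω | ξ ω ∈ S} +
      C * (μ.real {ω | ξ ω = i} * μ.real {ω | η ω = true}) +
      D * ((1 - μ.real {ω | ξ ω ∈ S}) * μ.real {ω | η ω = true}) := by
  have key : ∀ (c : ℝ) (p : ℕ → Bool → Prop) [∀ x b, Decidable (p x b)],
      Integrable (fun ω => c * (if p (ξ ω) (η ω) then 1 else 0)) μ ∧
        ∫ ω, c * (if p (ξ ω) (η ω) then 1 else 0) ∂μ = c * μ.real {ω | p (ξ ω) (η ω)} := by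
    intro c p _
    have hs : MeasurableSet {ω | p (ξ ω) (η ω)} :=
      (hξ.prodMk hη) (MeasurableSet.of_discrete (s := {q : ℕ × Bool | p q.1 q.2}))
    have he : (fun ω => if p (ξ ω) (η ω) then (1 : ℝ) else 0) =
        Set.indicator {ω | p (ξ ω) (η ω)} 1 := by
      ext ω; simp [Set.indicator_apply]
    constructor
    · refine Integrable.const_mul ?_ c
      rw [he]
      exact (integrable_const (1 : ℝ)).indicator hs
    · rw [integral_const_mul, he, integral_indicator_one hs]
  obtain ⟨i1, e1⟩ := key A fun x _ => x = i
  obtain ⟨i2, e2⟩ := key B fun x _ => x ∈ S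
  obtain ⟨i3, e3⟩ := key C fun x b => x = i ∧ b = true
  obtain ⟨i4, e4⟩ := key D fun x b => x ∉ S ∧ b = true
  have e3' : μ.real {ω | ξ ω = i ∧ η ω = true} =
      μ.real {ω | ξ ω = i} * μ.real {ω | η ω = true} := by
    have := h.measure_inter_preimage_eq_mul {i} {true} (measurableSet_singleton _)
      (measurableSet_singleton _)
    rw [measureReal_def, measureReal_def, measureReal_def, ← ENNReal.toReal_mul]
    exact congrArg _ this
  have e4' : μ.real {ω | ξ ω ∉ S ∧ η ω = true} =
      (1 - μ.real {ω | ξ ω ∈ S}) * μ.real {ω | η ω = true} := by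
    have hS : MeasurableSet {ω | ξ ω ∈ S} := hξ (MeasurableSet.of_discrete (s := (S : Set ℕ)))
    have hc : 1 - μ.real {ω | ξ ω ∈ S} = μ.real {ω | ξ ω ∉ S} :=
      (probReal_compl_eq_one_sub hS).symm
    have := h.measure_inter_preimage_eq_mul (S : Set ℕ)ᶜ {true} MeasurableSet.of_discrete
      (measurableSet_singleton _)
    rw [hc, measureReal_def, measureReal_def, measureReal_def, ← ENNReal.toReal_mul]
    exact congrArg _ this
  have i12 := i1.add i2
  have i123 := i12.add i3
  have s1 := integral_add i123 i4
  have s2 := integral_add i12 i3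
  have s3 := integral_add i1 i2
  simp only [Pi.add_apply] at s1 s2 s3
  rw [s1, s2, s3, e1, e2, e3, e4, e3', e4']

lemma measureReal_mem_finset [IsFiniteMeasure μ] {ξ : Ω → ℕ} (hξ : Measurable ξ) {p : ℕ → ℝ}
    (hp : ∀ i, μ.real {ω | ξ ω = i} = p i) (S : Finset ℕ) :
    μ.real {ω | ξ ω ∈ S} = ∑ i ∈ S, p i := by
  have h := measureReal_biUnion_finset (μ := μ) (s := S) (f := fun i => {ω | ξ ω = i})
    (fun i _ j _ hij => Set.disjoint_left.2 fun ω h1 h2 => hij (h1.symm.trans h2))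
    (fun i _ => hξ (measurableSet_singleton i))
  rw [← Finset.sum_congr rfl fun i _ => hp i, ← h]
  congr 1
  ext ω
  simp

lemma abs_mul_ite_le {c K : ℝ} (h : |c| ≤ K) (q : Prop) [Decidable q] :
    |c * (if q then 1 else 0)| ≤ K := by
  split_ifs
  · simpa using h
  · simpa using (abs_nonneg c).trans h

lemma abs_lyapunovGain_le {sel : CounterTable → ℕ} {m i : ℕ} {r β P κ : ℝ} (hr : 0 < r)
    (hr1 : r < 1) (hβ : 0 ≤ β) (hP : 0 < P) (hκ : 0 ≤ κ) (T : CounterTable) (x : ℕ) (b : Bool) :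
    |lyapunovGain sel m i r β P κ T x b| ≤
      (1 / P + 1) + ((1 / r - 1) / P + 2 / m / P + κ / m) + 1 / P +
        ((1 / r - 1) / P + β / P + κ / m) := by
  have hinv : 0 < 1 / r - 1 := by rw [sub_pos, lt_div_iff₀ hr]; linarith
  have hV0 : 0 ≤ risk sel i r T := risk_nonneg hr
  have hV1 : risk sel i r T ≤ 1 := risk_le_one hr hr1
  have hw0 : (0 : ℝ) < r ^ (minCount sel T - 1) := by positivity
  have hw1 : r ^ (minCount sel T - 1) ≤ 1 := pow_le_one₀ hr.le hr1.le
  have hP1 : 0 < 1 / P := by positivity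
  have hU : ∀ [Decidable (IsSafe sel i T)],
      0 ≤ (if IsSafe sel i T then (1 / r - 1) * risk sel i r T else 0) / P ∧
      (if IsSafe sel i T then (1 / r - 1) * risk sel i r T else 0) / P ≤ (1 / r - 1) / P := by
    intro _
    split_ifs
    · exact ⟨by positivity, div_le_div_of_nonneg_right (by nlinarith) hP.le⟩
    · simp only [zero_div, le_refl, true_and]; positivity
  have hκm : 0 ≤ κ / m := by positivity
  have h2m : 0 ≤ 2 / (m : ℝ) / P := by positivity
  unfold lyapunovGain
  refine (abs_add_le _ _).trans (add_le_add ((abs_add_le _ _).trans (add_le_add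
    ((abs_add_le _ _).trans (add_le_add ?_ ?_)) ?_)) ?_)
  · refine abs_mul_ite_le ?_ _
    split_ifs
    · have h1 : risk sel i r T / 2 / P ≤ 1 / P := div_le_div_of_nonneg_right (by linarith) hP.le
      have h2 : 0 ≤ risk sel i r T / 2 / P := by positivity
      rw [abs_le]; constructor <;> linarith
    · rw [abs_zero]; positivity
  · refine abs_mul_ite_le ?_ _
    obtain ⟨h1, h2⟩ := @hU (Classical.propDecidable _)
    rw [abs_le]; constructor <;> linarith
  · refine abs_mul_ite_le ?_ _
    split_ifs
    · rw [abs_zero]; positivity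
    · have h1 : (1 - r ^ (minCount sel T - 1)) / P ≤ 1 / P :=
        div_le_div_of_nonneg_right (by linarith) hP.le
      have h2 : 0 ≤ (1 - r ^ (minCount sel T - 1)) / P := div_nonneg (by linarith) hP.le
      rw [abs_neg, abs_le]; constructor <;> linarith
  · refine abs_mul_ite_le ?_ _
    obtain ⟨h1, h2⟩ := @hU (Classical.propDecidable _)
    have h3 : β * r ^ (minCount sel T - 1) / P ≤ β / P :=
      div_le_div_of_nonneg_right (by nlinarith) hP.le
    have h4 : 0 ≤ β * r ^ (minCount sel T - 1) / P := by positivity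
    have h5 : 0 ≤ β / P := by positivity
    have h6 : 0 ≤ (1 / r - 1) / P := by positivity
    rw [abs_le]; constructor <;> linarith

/-- The mean of the gain is negative if the arrival rate `p` of `i` exceeds the possible growth
rate of the minimum. Here `ps` bounds the probability that a monitored item arrives. The choice of
`r` balances the growth of the risk when minimal counters are incremented, at a rate of at most
`P + ps`, with its halving at each arrival of `i`. -/
lemma integral_lyapunovGain_le [IsProbabilityMeasure μ] {ξ : Ω → ℕ} {η : Ω → Bool}
    (hξ : Measurable ξ) (hη : Measurable η) (h : IndepFun ξ η μ) {sel : CounterTable → ℕ}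
    {m i : ℕ} {r P p ps κ : ℝ} (hr : 0 < r) (hr1 : r < 1) (hP : 0 < P) (hκ : 0 ≤ κ)
    (T : CounterTable) (hi : μ.real {ω | ξ ω = i} = p) (hη' : μ.real {ω | η ω = true} = P)
    (hT : μ.real {ω | ξ ω ∈ T.C} ≤ ps) (hps : ps < 1)
    (hrp : (1 / r - 1) * (P + ps) = p / 2) :
    ∫ ω, lyapunovGain sel m i r (p / (1 - ps)) P κ T (ξ ω) (η ω) ∂μ ≤
      -p + 2 / m * ps / P + κ / m * (P + ps) := by
  have hV0 : 0 ≤ risk sel i r T := risk_nonneg hr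
  have hV1 : risk sel i r T ≤ 1 := risk_le_one hr hr1
  have hw0 : (0 : ℝ) < r ^ (minCount sel T - 1) := by positivity
  have hinv : 0 < 1 / r - 1 := by rw [sub_pos, lt_div_iff₀ hr]; linarith
  have hp0 : 0 ≤ p := hi ▸ measureReal_nonneg
  unfold lyapunovGain
  rw [integral_arrival_events hξ hη h, hi, hη']
  set q := μ.real {ω | ξ ω ∈ T.C} with hq
  have hq0 : 0 ≤ q := measureReal_nonneg
  set w := r ^ (minCount sel T - 1) with hw
  set V := risk sel i r T with hV
  have hqP : q + (1 - q) * P ≤ P + ps := by nlinarith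
  have h1 : κ / m * (q + (1 - q) * P) ≤ κ / m * (P + ps) :=
    mul_le_mul_of_nonneg_left hqP (by positivity)
  have h2 : 2 / m / P * q ≤ 2 / m * ps / P := by
    calc 2 / m / P * q = 2 / (m : ℝ) * q / P := by ring
      _ ≤ _ := div_le_div_of_nonneg_right (mul_le_mul_of_nonneg_left hT (by positivity)) hP.le
  have h1ps : 0 < 1 - ps := by linarith
  have hβ0 : 0 ≤ p / (1 - ps) := by positivity
  have h3 : p * w ≤ p / (1 - ps) * w * (1 - q) := by
    have : p * w = p / (1 - ps) * w * (1 - ps) := by field_simp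
    rw [this]
    exact mul_le_mul_of_nonneg_left (by linarith) (by positivity)
  split_ifs with hs
  · have h4 : (1 / r - 1) * V / P * (q + (1 - q) * P) ≤ V * p / 2 / P := by
      calc (1 / r - 1) * V / P * (q + (1 - q) * P) ≤ (1 / r - 1) * V / P * (P + ps) :=
            mul_le_mul_of_nonneg_left hqP (by positivity)
        _ = ((1 / r - 1) * (P + ps)) * V / P := by ring
        _ = V * p / 2 / P := by rw [hrp]; ring
    have h5 : p / (1 - ps) * w / P * ((1 - q) * P) = p / (1 - ps) * w * (1 - q) := by
      field_simp
    have h6 : 0 ≤ p * w := by positivity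
    have h7 : V * p / 2 / P = V / 2 / P * p := by ring
    nlinarith
  · have h4 : (1 - w) / P * (p * P) = (1 - w) * p := by field_simp
    have h5 : p / (1 - ps) * w / P * ((1 - q) * P) = p / (1 - ps) * w * (1 - q) := by
      field_simp
    simp only [zero_div]
    nlinarith

/-- A sequence that grows by at most `f s` at each step from `t₀` on is eventually below
`-a t` if the partial sums of `f` are eventually below `-b t` with `a < b`. -/
lemma eventually_le_of_sum_le {u f : ℕ → ℝ} {t₀ : ℕ} (hu : ∀ t ≥ t₀, u (t + 1) ≤ u t + f t)
    {a b : ℝ} (hab : a < b)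
    (hf : ∀ᶠ t : ℕ in atTop, ∑ s ∈ Finset.range t, f s ≤ -b * t) :
    ∀ᶠ t : ℕ in atTop, u t ≤ -a * t := by
  have h1 : ∀ t ≥ t₀, u t ≤ u t₀ - ∑ s ∈ Finset.range t₀, f s + ∑ s ∈ Finset.range t, f s := by
    intro t ht
    induction t, ht using Nat.le_induction with
    | base => linarith
    | succ t ht ih => rw [Finset.sum_range_succ]; linarith [hu t ht]
  have h2 : Tendsto (fun t : ℕ => (b - a) * (t : ℝ)) atTop atTop :=
    tendsto_natCast_atTop_atTop.const_mul_atTop (by linarith)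
  filter_upwards [hf, eventually_ge_atTop t₀,
    h2.eventually_ge_atTop (u t₀ - ∑ s ∈ Finset.range t₀, f s)] with t h3 h4 h5
  linarith [h1 t h4]

variable {X : ℕ → Ω → ℕ} {B : ℕ → Ω → Bool} {sel : CounterTable → ℕ} {m : ℕ} {p : ℕ → ℝ}
  {P ps : ℝ}

lemma IsAdmissionCoins.indepFun_apply (hB : IsAdmissionCoins μ P X B) (t : ℕ) :
    IndepFun (X t) (B t) μ :=
  hB.indep_stream.comp (measurable_pi_apply t) (measurable_pi_apply t)

/-- An item that arrives often enough is eventually monitored forever. -/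
theorem ae_eventually_mem [IsProbabilityMeasure μ] (hX : ∀ t, Measurable (X t))
    (hXi : iIndepFun X μ) (hp : ∀ t i, μ.real {ω | X t ω = i} = p i)
    (hB : IsAdmissionCoins μ P X B) (hsel : IsArgmin sel) (hm : 1 ≤ m)
    (hps : ∀ S : Finset ℕ, S.card ≤ m → ∑ j ∈ S, p j ≤ ps)
    (hfull : ∀ᵐ ω ∂μ, ∀ᶠ t in atTop,
      (rapRun sel m (fun s => X s ω) (fun s => B s ω) t).C.card = m)
    (hP : 0 < P) (hpsP : ps ≤ P) (hps2 : ps ≤ 1 / 2) {i : ℕ} (hiP : p i ≤ P)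
    (hi : 2 / m * ps / P + 22 / m * P < p i) :
    ∀ᵐ ω ∂μ, ∀ᶠ t in atTop, i ∈ (rapRun sel m (fun s => X s ω) (fun s => B s ω) t).C := by
  have hm' : (0 : ℝ) < m := by exact_mod_cast hm
  have hps0 : 0 ≤ ps := by simpa using hps ∅ (by simp)
  have hpi : 0 < p i := lt_of_le_of_lt (by positivity) hi
  have hq : 0 < P + ps := by linarith
  set ρ : ℝ := p i / (2 * (P + ps)) with hρ
  have hρ0 : 0 < ρ := by positivity
  set r : ℝ := 1 / (1 + ρ) with hr
  have hr0 : 0 < r := by positivity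
  have hr1 : r < 1 := by rw [hr, div_lt_one (by positivity)]; linarith
  have hinv : 1 / r - 1 = ρ := by rw [hr]; field_simp; ring
  have hrp : (1 / r - 1) * (P + ps) = p i / 2 := by rw [hinv, hρ]; field_simp
  set β : ℝ := p i / (1 - ps) with hβ
  have h1ps : 0 < 1 - ps := by linarith
  have hβ0 : 0 ≤ β := by positivity
  have hmp : 22 * P ≤ m * p i := by
    have h1 : 22 / (m : ℝ) * P ≤ p i := by
      have : 0 ≤ 2 / (m : ℝ) * ps / P := by positivity
      linarith
    rw [div_mul_eq_mul_div, div_le_iff₀ hm'] at h1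
    linarith
  have hrm : ∀ n, m ≤ 2 * n → 2 * r ^ n ≤ 1 := by
    intro n hn
    have hn' : (m : ℝ) ≤ 2 * n := by exact_mod_cast hn
    have h1 : 1 ≤ n * ρ := by
      rw [hρ, mul_div_assoc', le_div_iff₀ (by positivity)]
      nlinarith
    have h2 := one_add_mul_le_pow (show (-2 : ℝ) ≤ ρ by linarith) n
    rw [hr, one_div, inv_pow, ← div_eq_mul_inv, div_le_one (by positivity)]
    linarith
  have hκ : β / (1 - r) / P + 1 ≤ 11 := by
    have h1 : β ≤ 2 * p i := by
      rw [hβ, div_le_iff₀ h1ps]; nlinarith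
    have h2 : β / (1 - r) = β + β / ρ := by
      rw [show 1 - r = ρ / (1 + ρ) by rw [hr]; field_simp; ring]
      field_simp
      ring
    have h3 : β / ρ ≤ 4 * (P + ps) := by
      rw [div_le_iff₀ hρ0, hρ, mul_div_assoc', le_div_iff₀ (by positivity)]
      nlinarith
    have h4 : β / (1 - r) / P ≤ 10 := by
      rw [h2, div_le_iff₀ hP]
      linarith
    linarith
  set δ : ℝ := (p i - (2 / m * ps / P + 22 / m * P)) / 2 with hδ
  have hδ0 : 0 < δ := by rw [hδ]; linarith
  have hdrift := ae_eventually_sum_nonpos (μ := μ) (m := m)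
    (f := fun T x b => lyapunovGain sel m i r β P 11 T x b + δ) hX hB.measurable hXi hB.indep
    hB.indep_stream hsel hδ0
    (fun T x b => (abs_add_le _ _).trans (add_le_add
      (abs_lyapunovGain_le hr0 hr1 hβ0 hP (by norm_num) T x b) le_rfl)) (fun t T hT => by
      have h1 := integral_lyapunovGain_le (sel := sel) (m := m) (κ := 11) (hX t) (hB.measurable t)
        (hB.indepFun_apply t) hr0 hr1 hP (by norm_num) T (hp t i) (hB.law t)
        (by rw [measureReal_mem_finset (hX t) (hp t)]; exact hps _ hT) (by linarith) hrp
      have h2 : Integrable (fun ω => lyapunovGain sel m i r β P 11 T (X t ω) (B t ω)) μ := by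
        refine Integrable.of_bound ?_ _
          (ae_of_all _ fun ω => abs_lyapunovGain_le hr0 hr1 hβ0 hP (by norm_num) T _ _)
        exact ((Measurable.of_discrete
          (f := fun q : ℕ × Bool => lyapunovGain sel m i r β P 11 T q.1 q.2)).comp
          ((hX t).prodMk (hB.measurable t))).aestronglyMeasurable
      rw [integral_add h2 (integrable_const _)]
      simp only [integral_const, probReal_univ, smul_eq_mul, one_mul]
      have h3 : 11 / (m : ℝ) * (P + ps) ≤ 22 / m * P := by
        have : 11 / (m : ℝ) * (P + ps) ≤ 11 / m * (P + P) := by gcongr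
        linarith [show 11 / (m : ℝ) * (P + P) = 22 / m * P by ring]
      linarith)
  filter_upwards [hdrift, hfull] with ω h1 h2
  obtain ⟨t₀, ht₀⟩ := eventually_atTop.1 h2
  have h3 := eventually_le_of_sum_le
    (u := fun t => lyapunov sel m i r β P 11 (rapRun sel m (fun s => X s ω) (fun s => B s ω) t))
    (fun t ht => lyapunov_add_le hsel hr0 hr1 hm hrm hβ0 hP (ht₀ t ht) (X t ω) (B t ω))
    (half_lt_self hδ0) (by
      filter_upwards [h1] with t ht
      rw [Finset.sum_add_distrib] at ht
      simp only [Finset.sum_const, Finset.card_range, nsmul_eq_mul] at ht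
      linarith)
  filter_upwards [h3, eventually_ge_atTop t₀, eventually_gt_atTop 0] with t h4 h5 h6
  by_contra hmem
  have h7 := lyapunov_nonneg hsel hr0 hr1 hm hβ0 hP hκ (ht₀ t h5) hmem
  have h8 : 0 < δ / 2 * t := mul_pos (half_pos hδ0) (by exact_mod_cast h6)
  linarith

/-- The sum of the counters grows at most at the rate of admissions and monitored arrivals. -/
theorem ae_eventually_total_le [IsProbabilityMeasure μ] (hX : ∀ t, Measurable (X t))
    (hXi : iIndepFun X μ) (hp : ∀ t i, μ.real {ω | X t ω = i} = p i)
    (hB : IsAdmissionCoins μ P X B) (hsel : IsArgmin sel) (hm : 1 ≤ m)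
    (hps : ∀ S : Finset ℕ, S.card ≤ m → ∑ j ∈ S, p j ≤ ps)
    (hfull : ∀ᵐ ω ∂μ, ∀ᶠ t in atTop,
      (rapRun sel m (fun s => X s ω) (fun s => B s ω) t).C.card = m)
    (hP : 0 ≤ P) {q : ℝ} (hq : ps + P < q) :
    ∀ᵐ ω ∂μ, ∀ᶠ t : ℕ in atTop,
      ((rapRun sel m (fun s => X s ω) (fun s => B s ω) t).total : ℝ) ≤ q * t := by
  classical
  set δ : ℝ := (q - (ps + P)) / 2 with hδ
  have hδ0 : 0 < δ := by rw [hδ]; linarith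
  set g : CounterTable → ℕ → Bool → ℝ := fun T x b =>
    0 * (if x = 0 then 1 else 0) + 1 * (if x ∈ T.C then 1 else 0) +
      0 * (if x = 0 ∧ b = true then 1 else 0) + 1 * (if x ∉ T.C ∧ b = true then 1 else 0) with hg
  have hg1 : ∀ T x b, |g T x b| ≤ 2 := by
    intro T x b
    simp only [hg]
    split_ifs <;> norm_num
  have hdrift := ae_eventually_sum_nonpos (μ := μ) (m := m)
    (f := fun T x b => g T x b - (ps + P + δ)) hX hB.measurable hXi hB.indep
    hB.indep_stream hsel hδ0
    (fun T x b => (abs_sub _ _).trans (add_le_add (hg1 T x b) le_rfl)) (fun t T hT => by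
      have h1 := integral_arrival_events (hX t) (hB.measurable t) (hB.indepFun_apply t)
        0 1 0 1 0 T.C
      have h2 : Integrable (fun ω => g T (X t ω) (B t ω)) μ := by
        refine Integrable.of_bound ?_ _ (ae_of_all _ fun ω => hg1 T _ _)
        exact ((Measurable.of_discrete (f := fun q : ℕ × Bool => g T q.1 q.2)).comp
          ((hX t).prodMk (hB.measurable t))).aestronglyMeasurable
      have h3 : μ.real {ω | X t ω ∈ T.C} ≤ ps := by
        rw [measureReal_mem_finset (hX t) (hp t)]; exact hps _ hT
      have h4 : 0 ≤ μ.real {ω | X t ω ∈ T.C} := measureReal_nonneg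
      rw [integral_sub h2 (integrable_const _)]
      simp only [integral_const, probReal_univ, smul_eq_mul, one_mul]
      rw [h1, hB.law t]
      nlinarith)
  filter_upwards [hdrift, hfull] with ω h1 h2
  obtain ⟨t₀, ht₀⟩ := eventually_atTop.1 h2
  have h3 := eventually_le_of_sum_le (a := -q) (b := -(ps + P + δ))
    (u := fun t => ((rapRun sel m (fun s => X s ω) (fun s => B s ω) t).total : ℝ))
    (f := fun t => g (rapRun sel m (fun s => X s ω) (fun s => B s ω) t) (X t ω) (B t ω))
    (t₀ := t₀) (fun t ht => by
      have hT := ht₀ t ht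
      simp only [rapRun]
      generalize rapRun sel m (fun s => X s ω) (fun s => B s ω) t = T at *
      rcases add_cases hsel hT.le hm (B t ω) (X t ω) with
        ⟨hx, e⟩ | ⟨hx, h', -⟩ | ⟨hx, -, hb, hs, e⟩ | ⟨hx, -, hb, e⟩
      · rw [e, total_bump hx (Finset.notMem_erase _ _)]
        simp [hg, hx]
      · omega
      · rw [e, total_bump hs (fun H => hx (Finset.mem_of_mem_erase H))]
        simp [hg, hx, hb]
      · rw [e]
        simp [hg, hx, hb])
    (by linarith) (by
      filter_upwards [h1] with t ht
      rw [Finset.sum_sub_distrib] at ht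
      simp only [Finset.sum_const, Finset.card_range, nsmul_eq_mul] at ht
      linarith)
  filter_upwards [h3] with t ht
  linarith

end Recurrence

/-! ### Estimates for the Zipf distribution -/

section Zipf

lemma rpow_neg_le_sub_div {α : ℝ} (hα₀ : 0 < α) (hα₁ : α < 1) (n : ℕ) :
    ((n + 1 : ℕ) : ℝ) ^ (-α) ≤ (((n + 1 : ℕ) : ℝ) ^ (1 - α) - (n : ℝ) ^ (1 - α)) / (1 - α) := by
  set N : ℝ := ((n + 1 : ℕ) : ℝ) with hN
  have hN1 : 1 ≤ N := by rw [hN]; push_cast; linarith [Nat.cast_nonneg (α := ℝ) n]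
  have hN0 : 0 < N := by linarith
  have hα : 0 < 1 - α := by linarith
  have hu : -1 ≤ -(1 / N) := by
    rw [neg_le_neg_iff, div_le_one hN0]; exact hN1
  have h1 := rpow_one_add_le_one_add_mul_self hu hα.le (by linarith : 1 - α ≤ 1)
  have h2 : (n : ℝ) = N * (1 + -(1 / N)) := by
    rw [mul_add, mul_neg, mul_one_div_cancel hN0.ne', hN]; push_cast; ring
  have h3 : N ^ (1 - α) = N * N ^ (-α) := by
    rw [show (1 - α) = 1 + -α by ring, Real.rpow_add hN0, Real.rpow_one]
  have hpos : 0 < N ^ (-α) := Real.rpow_pos_of_pos hN0 _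
  rw [le_div_iff₀ hα, h2, Real.mul_rpow hN0.le (by linarith)]
  have h4 : N ^ (1 - α) * (1 + -(1 / N)) ^ (1 - α) ≤
      N ^ (1 - α) * (1 + (1 - α) * -(1 / N)) :=
    mul_le_mul_of_nonneg_left h1 (Real.rpow_nonneg hN0.le _)
  have h5 : N ^ (1 - α) * (1 + (1 - α) * -(1 / N)) = N ^ (1 - α) - (1 - α) * N ^ (-α) := by
    rw [h3]; field_simp; ring
  linarith

lemma sum_rpow_neg_le {α : ℝ} (hα₀ : 0 < α) (hα₁ : α < 1) (n : ℕ) :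
    ∑ i ∈ Finset.Icc 1 n, (i : ℝ) ^ (-α) ≤ (n : ℝ) ^ (1 - α) / (1 - α) := by
  induction n with
  | zero => simp [Real.zero_rpow (show 1 - α ≠ 0 by linarith)]
  | succ n ih =>
    rw [Finset.sum_Icc_succ_top (by omega)]
    have := rpow_neg_le_sub_div hα₀ hα₁ n
    rw [sub_div] at this
    linarith

lemma rpow_le_zipfGamma {α : ℝ} (hα₀ : 0 < α) {D : ℕ} (hD : 1 ≤ D) :
    (D : ℝ) ^ (1 - α) ≤ zipfGamma α D := by
  have hD0 : (0 : ℝ) < D := by exact_mod_cast hD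
  have h := Finset.card_nsmul_le_sum (Finset.Icc 1 D) (fun i : ℕ => (i : ℝ) ^ (-α))
    ((D : ℝ) ^ (-α)) (fun i hi => by
      rw [Finset.mem_Icc] at hi
      exact Real.rpow_le_rpow_of_nonpos (by exact_mod_cast hi.1) (by exact_mod_cast hi.2)
        (by linarith))
  rw [Nat.card_Icc, Nat.add_sub_cancel, nsmul_eq_mul] at h
  rwa [show (1 - α) = 1 + -α by ring, Real.rpow_add hD0, Real.rpow_one]

lemma zipfGamma_pos {α : ℝ} (hα₀ : 0 < α) {D : ℕ} (hD : 1 ≤ D) : 0 < zipfGamma α D :=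
  (Real.rpow_pos_of_pos (by exact_mod_cast hD) _).trans_le (rpow_le_zipfGamma hα₀ hD)

lemma mul_zipfGamma_le {α : ℝ} (hα₀ : 0 < α) (hα₁ : α < 1) (D : ℕ) :
    (1 - α) * zipfGamma α D ≤ (D : ℝ) ^ (1 - α) := by
  have := sum_rpow_neg_le hα₀ hα₁ D
  rw [le_div_iff₀ (by linarith)] at this
  unfold zipfGamma
  linarith

/-- The probability of the item `i` in the Zipf distribution over `{1, …, D}`. -/
noncomputable def zipfWeight (α : ℝ) (D i : ℕ) : ℝ :=
  if i ∈ Finset.Icc 1 D then (i : ℝ) ^ (-α) / zipfGamma α D else 0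

lemma zipfWeight_of_mem {α : ℝ} {D i : ℕ} (hi : i ∈ Finset.Icc 1 D) :
    zipfWeight α D i = (i : ℝ) ^ (-α) / zipfGamma α D := if_pos hi

lemma zipfWeight_le {α : ℝ} (hα₀ : 0 < α) {D n i : ℕ} (hD : 1 ≤ D) (hn : 1 ≤ n) (hi : n ≤ i) :
    zipfWeight α D i ≤ (n : ℝ) ^ (-α) / zipfGamma α D := by
  have hΓ := zipfGamma_pos hα₀ hD
  unfold zipfWeight
  split_ifs
  · refine div_le_div_of_nonneg_right ?_ hΓ.le
    exact Real.rpow_le_rpow_of_nonpos (by exact_mod_cast hn) (by exact_mod_cast hi) (by linarith)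
  · positivity

/-- The probability of a set of at most `m` items. The constant `2` allows for a proof without a
rearrangement: the items up to `m` are bounded by the sum of all their weights, and each of the
others by the weight of `m`. -/
lemma sum_zipfWeight_le {α : ℝ} (hα₀ : 0 < α) (hα₁ : α < 1) {D m : ℕ} (hD : 1 ≤ D) (hm : 1 ≤ m)
    (S : Finset ℕ) (hS : S.card ≤ m) :
    ∑ j ∈ S, zipfWeight α D j ≤ 2 * (m : ℝ) ^ (1 - α) / ((1 - α) * zipfGamma α D) := by
  have hΓ := zipfGamma_pos hα₀ hD
  have hα : 0 < 1 - α := by linarith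
  have hm0 : (0 : ℝ) < m := by exact_mod_cast hm
  have hpt : ∀ j ∈ S, zipfWeight α D j ≤
      (if j ∈ Finset.Icc 1 m then (j : ℝ) ^ (-α) / zipfGamma α D else 0) +
        (m : ℝ) ^ (-α) / zipfGamma α D := by
    intro j _
    by_cases hj : j ∈ Finset.Icc 1 m
    · rw [if_pos hj]
      have h1 := zipfWeight_le hα₀ hD (Finset.mem_Icc.1 hj).1 le_rfl
      have h2 : 0 ≤ (m : ℝ) ^ (-α) / zipfGamma α D := by positivity
      linarith
    · rw [if_neg hj, zero_add]
      rcases Nat.eq_zero_or_pos j with rfl | hj0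
      · rw [zipfWeight, if_neg (by simp)]; positivity
      · refine zipfWeight_le hα₀ hD hm ?_
        rw [Finset.mem_Icc] at hj
        omega
  have h1 : ∑ j ∈ S, (if j ∈ Finset.Icc 1 m then (j : ℝ) ^ (-α) / zipfGamma α D else 0) ≤
      (m : ℝ) ^ (1 - α) / (1 - α) / zipfGamma α D := by
    rw [← Finset.sum_filter, ← Finset.sum_div]
    refine div_le_div_of_nonneg_right (le_trans ?_ (sum_rpow_neg_le hα₀ hα₁ m)) hΓ.le
    exact Finset.sum_le_sum_of_subset_of_nonneg
      (fun j hj => (Finset.mem_filter.1 hj).2) (fun j _ _ => by positivity)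
  have h2 : ∑ _j ∈ S, (m : ℝ) ^ (-α) / zipfGamma α D ≤
      (m : ℝ) ^ (1 - α) / (1 - α) / zipfGamma α D := by
    rw [Finset.sum_const, nsmul_eq_mul, ← mul_div_assoc]
    refine div_le_div_of_nonneg_right ?_ hΓ.le
    have h3 : (m : ℝ) ^ (1 - α) = m * (m : ℝ) ^ (-α) := by
      rw [show (1 - α) = 1 + -α by ring, Real.rpow_add hm0, Real.rpow_one]
    have h4 : (S.card : ℝ) * (m : ℝ) ^ (-α) ≤ m * (m : ℝ) ^ (-α) :=
      mul_le_mul_of_nonneg_right (by exact_mod_cast hS) (by positivity)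
    rw [le_div_iff₀ hα, h3]
    have : 0 ≤ (S.card : ℝ) * (m : ℝ) ^ (-α) := by positivity
    nlinarith
  calc ∑ j ∈ S, zipfWeight α D j ≤ _ := Finset.sum_le_sum hpt
    _ ≤ (m : ℝ) ^ (1 - α) / (1 - α) / zipfGamma α D +
        (m : ℝ) ^ (1 - α) / (1 - α) / zipfGamma α D := by
      rw [Finset.sum_add_distrib]; exact add_le_add h1 h2
    _ = _ := by field_simp; ring

end Zipf

/-! ### Zipf streams -/

section Stream

variable {Ω : Type*} [MeasurableSpace Ω] {μ : Measure Ω} {X : ℕ → Ω → ℕ} {α : ℝ} {D : ℕ}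

lemma IsZipfStream.measureReal_eq [IsProbabilityMeasure μ] (h : IsZipfStream μ α D X)
    (hα₀ : 0 < α) (hD : 1 ≤ D) (t i : ℕ) : μ.real {ω | X t ω = i} = zipfWeight α D i := by
  by_cases hi : i ∈ Finset.Icc 1 D
  · rw [zipfWeight_of_mem hi, h.law t i hi]
  rw [zipfWeight, if_neg hi]
  have h1 : μ.real {ω | X t ω ∈ Finset.Icc 1 D} = 1 := by
    rw [measureReal_mem_finset (h.measurable t) (fun _ => rfl),
      Finset.sum_congr rfl (h.law t), ← Finset.sum_div]
    exact div_self (zipfGamma_pos hα₀ hD).ne'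
  have h2 : MeasurableSet {ω | X t ω ∈ Finset.Icc 1 D} :=
    h.measurable t (MeasurableSet.of_discrete (s := (Finset.Icc 1 D : Set ℕ)))
  have h3 := probReal_compl_eq_one_sub (μ := μ) h2
  rw [h1, sub_self] at h3
  refine le_antisymm (h3 ▸ measureReal_mono fun ω hω hmem => hi ?_) measureReal_nonneg
  have hω : X t ω = i := hω
  rw [← hω]
  exact hmem

/-- The frequencies of all items are eventually close to their probabilities, uniformly. -/
lemma IsZipfStream.ae_arrivals [IsProbabilityMeasure μ] (h : IsZipfStream μ α D X)
    (hα₀ : 0 < α) (hD : 1 ≤ D) {ε : ℝ} (hε : 0 < ε) :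
    ∀ᵐ ω ∂μ, ∀ᶠ t : ℕ in atTop, ∀ j,
      |(arrivals (fun s => X s ω) j t : ℝ) - zipfWeight α D j * t| ≤ ε * t := by
  have h1 : ∀ᵐ ω ∂μ, ∀ j, Tendsto (fun t : ℕ => (arrivals (fun s => X s ω) j t : ℝ) / t) atTop
      (𝓝 (zipfWeight α D j)) :=
    ae_all_iff.2 fun j => ae_tendsto_arrivals h.measurable h.indep (h.measureReal_eq hα₀ hD) j
  have h2 : ∀ᵐ ω ∂μ, ∀ t j, j ∉ Finset.Icc 1 D → X t ω ≠ j := by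
    refine ae_all_iff.2 fun t => ae_all_iff.2 fun j => ?_
    by_cases hj : j ∈ Finset.Icc 1 D
    · exact ae_of_all _ fun _ hj' => absurd hj hj'
    · have h3 := h.measureReal_eq hα₀ hD t j
      rw [zipfWeight, if_neg hj, measureReal_eq_zero_iff] at h3
      filter_upwards [measure_eq_zero_iff_ae_notMem.1 h3] with ω hω _
      exact hω
  filter_upwards [h1, h2] with ω h1 h2
  have h3 : ∀ᶠ t : ℕ in atTop, ∀ j ∈ Finset.Icc 1 D,
      |(arrivals (fun s => X s ω) j t : ℝ) / t - zipfWeight α D j| < ε :=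
    (Finset.Icc 1 D).eventually_all.2 fun j _ => by
      simpa [Real.dist_eq] using (Metric.tendsto_nhds.1 (h1 j)) ε hε
  filter_upwards [h3, eventually_gt_atTop 0] with t h4 h5 j
  have ht : (0 : ℝ) < t := by exact_mod_cast h5
  by_cases hj : j ∈ Finset.Icc 1 D
  · have h6 : (arrivals (fun s => X s ω) j t : ℝ) - zipfWeight α D j * t =
        ((arrivals (fun s => X s ω) j t : ℝ) / t - zipfWeight α D j) * t := by field_simp
    rw [h6, abs_mul, abs_of_pos ht]
    exact mul_le_mul_of_nonneg_right (h4 j hj).le ht.le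
  · have h6 : arrivals (fun s => X s ω) j t = 0 :=
      Finset.sum_eq_zero fun s _ => if_neg (h2 s j hj)
    rw [h6, zipfWeight, if_neg hj]
    simp only [Nat.cast_zero, zero_mul, sub_zero, abs_zero]
    positivity

lemma tendsto_measureReal_one_of_ae [IsProbabilityMeasure μ] {A : ℕ → Set Ω}
    (hA : ∀ t, MeasurableSet (A t)) (h : ∀ᵐ ω ∂μ, ∀ᶠ t in atTop, ω ∈ A t) :
    Tendsto (fun t => μ.real (A t)) atTop (𝓝 1) := by
  have h1 := tendsto_measure_of_ae_tendsto_indicator_of_isFiniteMeasure (μ := μ) atTop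
    MeasurableSet.univ hA (by
      filter_upwards [h] with ω hω
      filter_upwards [hω] with t ht
      simp [ht])
  rw [measure_univ] at h1
  simpa [measureReal_def, Function.comp_def] using (ENNReal.tendsto_toReal ENNReal.one_ne_top).comp h1

lemma measurableSet_identifiesTop (hX : ∀ t, Measurable (X t)) {B : ℕ → Ω → Bool}
    (hB : ∀ t, Measurable (B t)) (sel : CounterTable → ℕ) (k m t : ℕ) :
    MeasurableSet {ω | IdentifiesTop k (rapRun sel m (fun s => X s ω) (fun s => B s ω) t)} :=
  measurableSet_setOfPred.2 (measurable_of_eq_on_lt (t := t) hX hB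
    (g := fun x b => IdentifiesTop k (rapRun sel m x b t))
    fun x x' b b' hx hb => by simp only [rapRun_congr hx hb])

end Stream

section Solves

open CounterTable

variable {Ω : Type*} [MeasurableSpace Ω] {μ : Measure Ω} {X : ℕ → Ω → ℕ} {α : ℝ} {D : ℕ}
  {sel : CounterTable → ℕ} {k m : ℕ}

/-! ### Space Saving -/

/-- The expected growth of the largest counter shows that Space Saving needs `m` to be at least the
inverse of the probability of a top item. -/
lemma one_le_of_spaceSavingSolves [IsProbabilityMeasure μ] (hX : ∀ t, Measurable (X t))
    (hk : 1 ≤ k) (hsel : IsArgmin sel) (hm : 1 ≤ m) {q : ℝ}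
    (hq : ∀ t, μ.real {ω | X t ω ∈ Finset.Icc 1 k} = q) (h : SpaceSavingSolves μ X sel k m) :
    1 ≤ m * q := by
  classical
  set a : ℕ → ℝ := fun t =>
    μ.real {ω | IdentifiesTop k (spaceSavingRun sel m (fun s => X s ω) t)} with ha
  have hA : ∀ t, MeasurableSet
      {ω | IdentifiesTop k (spaceSavingRun sel m (fun s => X s ω) t)} := fun t =>
    measurableSet_identifiesTop (B := fun _ _ => true) hX (fun _ => measurable_const) sel k m t
  have hT : ∀ t, MeasurableSet {ω | X t ω ∈ Finset.Icc 1 k} := fun t =>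
    hX t (MeasurableSet.of_discrete (s := (Finset.Icc 1 k : Set ℕ)))
  have i1 : ∀ s, Integrable ({ω | X s ω ∈ Finset.Icc 1 k}.indicator (1 : Ω → ℝ)) μ := fun s =>
    (integrable_const (1 : ℝ)).indicator (hT s)
  have i2 : ∀ s, Integrable ({ω | IdentifiesTop k
      (spaceSavingRun sel m (fun s => X s ω) (s + 1))}ᶜ.indicator (1 : Ω → ℝ)) μ := fun s =>
    (integrable_const (1 : ℝ)).indicator (hA (s + 1)).compl
  have hle : ∀ t : ℕ, (t : ℝ) ≤ m * ∑ s ∈ Finset.range t, (q + (1 - a (s + 1))) := by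
    intro t
    have h1 : ∀ ω, (t : ℝ) ≤ m * ∑ s ∈ Finset.range t,
        ({ω | X s ω ∈ Finset.Icc 1 k}.indicator (1 : Ω → ℝ) ω + {ω | IdentifiesTop k
          (spaceSavingRun sel m (fun s => X s ω) (s + 1))}ᶜ.indicator (1 : Ω → ℝ) ω) := by
      intro ω
      have h2 := time_le_of_spaceSaving (x := fun s => X s ω) hk hsel hm t
      have h3 : (t : ℝ) ≤ m * ∑ s ∈ Finset.range t,
          ((if X s ω ∈ Finset.Icc 1 k then (1 : ℝ) else 0) + if IdentifiesTop k
            (spaceSavingRun sel m (fun s => X s ω) (s + 1)) then (0 : ℝ) else 1) := by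
        exact_mod_cast h2
      refine h3.trans (le_of_eq ?_)
      congr 1
      refine Finset.sum_congr rfl fun s _ => ?_
      simp only [Set.indicator_apply, Set.mem_ofPred_eq, Set.mem_compl_iff, Pi.one_apply, ite_not]
    have i3 : ∀ s, Integrable (fun ω => {ω | X s ω ∈ Finset.Icc 1 k}.indicator (1 : Ω → ℝ) ω +
        {ω | IdentifiesTop k
          (spaceSavingRun sel m (fun s => X s ω) (s + 1))}ᶜ.indicator (1 : Ω → ℝ) ω) μ :=
      fun s => (i1 s).add (i2 s)
    have h4 := integral_mono (μ := μ) (integrable_const (t : ℝ))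
      ((integrable_finsetSum (Finset.range t) fun s _ => i3 s).const_mul (m : ℝ)) h1
    simp only [integral_const, probReal_univ, smul_eq_mul, one_mul] at h4
    rw [integral_const_mul, integral_finsetSum _ fun s _ => i3 s] at h4
    refine h4.trans (le_of_eq ?_)
    congr 1
    refine Finset.sum_congr rfl fun s _ => ?_
    rw [integral_add (i1 s) (i2 s), integral_indicator_one (hT s),
      integral_indicator_one (hA (s + 1)).compl, hq, probReal_compl_eq_one_sub (hA (s + 1))]
  have hlim : Tendsto (fun s => q + (1 - a (s + 1))) atTop (𝓝 (q + (1 - 1))) :=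
    tendsto_const_nhds.add (tendsto_const_nhds.sub ((tendsto_add_atTop_iff_nat 1).2 h))
  have hces := hlim.cesaro.const_mul (m : ℝ)
  rw [sub_self, add_zero] at hces
  refine ge_of_tendsto hces ?_
  filter_upwards [eventually_gt_atTop 0] with t ht
  have ht' : (0 : ℝ) < t := by exact_mod_cast ht
  have := hle t
  rw [← mul_assoc, mul_comm (m : ℝ), mul_assoc, inv_mul_eq_div, le_div_iff₀ ht']
  linarith

/-- Space Saving overestimates frequencies by at most `t / m`, hence it solves top-`k` if `1 / m` is
less than the gap between the probabilities of the items `k` and `k + 1`. -/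
lemma spaceSavingSolves_of_gap [IsProbabilityMeasure μ] (h : IsZipfStream μ α D X) (hα₀ : 0 < α)
    (hk : 1 ≤ k) (hkD : k ≤ D) (hsel : IsArgmin sel) (hm : 1 ≤ m)
    (hgap : ((k + 1 : ℕ) : ℝ) ^ (-α) / zipfGamma α D + 1 / m < (k : ℝ) ^ (-α) / zipfGamma α D) :
    SpaceSavingSolves μ X sel k m := by
  have hD : 1 ≤ D := hk.trans hkD
  have hΓ := zipfGamma_pos hα₀ hD
  have hm' : (0 : ℝ) < m := by exact_mod_cast hm
  set p := (k : ℝ) ^ (-α) / zipfGamma α D with hp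
  set p' := ((k + 1 : ℕ) : ℝ) ^ (-α) / zipfGamma α D with hp'
  set ε := (p - (p' + 1 / m)) / 4 with hε
  have hε0 : 0 < ε := by rw [hε]; linarith
  have hp'0 : 0 ≤ p' := by positivity
  refine tendsto_measureReal_one_of_ae (fun t =>
    measurableSet_identifiesTop (B := fun _ _ => true) h.measurable
      (fun _ => measurable_const) sel k m t) ?_
  filter_upwards [h.ae_arrivals hα₀ hD hε0] with ω hω
  filter_upwards [hω, eventually_gt_atTop 0] with t ht ht0
  have ht' : (0 : ℝ) < t := by exact_mod_cast ht0
  have hεt : 0 < ε * t := by positivity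
  have h1m : 0 < 1 / (m : ℝ) := by positivity
  have hcard : (spaceSavingRun sel m (fun s => X s ω) t).C.card ≤ m := card_rapRun_le hsel t
  have hlev : (level sel m (spaceSavingRun sel m (fun s => X s ω) t) : ℝ) ≤ 1 / m * t := by
    have h1 := mul_level_le_total hsel hcard
    rw [total_spaceSavingRun hsel hm] at h1
    have h2 : (m : ℝ) * level sel m (spaceSavingRun sel m (fun s => X s ω) t) ≤ t := by
      exact_mod_cast h1
    rw [one_div_mul_eq_div, le_div_iff₀ hm']
    linarith
  have hsep : (p' + 1 / m + ε) * t < (p - ε) * t :=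
    mul_lt_mul_of_pos_right (by rw [hε]; linarith) ht'
  refine identifiesTop_of_threshold ((p' + 1 / m + ε) * t) (fun i hi => ?_) (fun j hj hjk => ?_)
  · rw [Finset.mem_Icc] at hi
    have hpi : p ≤ zipfWeight α D i := by
      rw [zipfWeight_of_mem (Finset.mem_Icc.2 ⟨hi.1, hi.2.trans hkD⟩)]
      refine div_le_div_of_nonneg_right ?_ hΓ.le
      exact Real.rpow_le_rpow_of_nonpos (by exact_mod_cast hi.1) (by exact_mod_cast hi.2)
        (by linarith)
    have h1 := (abs_le.1 (ht i)).1
    have h2 : p * t ≤ zipfWeight α D i * t := mul_le_mul_of_nonneg_right hpi ht'.le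
    have h3 : (arrivals (fun s => X s ω) i t : ℝ) ≤
        estimate sel m i (spaceSavingRun sel m (fun s => X s ω) t) := by
      exact_mod_cast arrivals_le_estimate (x := fun s => X s ω) hsel hm i t
    have hmem : i ∈ (spaceSavingRun sel m (fun s => X s ω) t).C := by
      by_contra hmem
      rw [estimate, if_neg hmem] at h3
      have : 0 ≤ p' * t := by positivity
      nlinarith
    rw [estimate, if_pos hmem] at h3
    exact ⟨hmem, by linarith⟩
  · have h1 := (abs_le.1 (ht j)).2
    have h2 : (((spaceSavingRun sel m (fun s => X s ω) t).c j : ℕ) : ℝ) ≤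
        arrivals (fun s => X s ω) j t +
          level sel m (spaceSavingRun sel m (fun s => X s ω) t) := by
      exact_mod_cast rapRun_counter_le hsel hm j t hj
    have hpj : zipfWeight α D j ≤ p' := by
      rcases Nat.eq_zero_or_pos j with rfl | hj0
      · rw [zipfWeight, if_neg (by simp)]; exact hp'0
      · rw [Finset.mem_Icc] at hjk
        exact zipfWeight_le hα₀ hD (by omega) (by omega)
    have h3 : zipfWeight α D j * t ≤ p' * t := mul_le_mul_of_nonneg_right hpj ht'.le
    linarith

/-! ### Randomized admission -/

/-- With fewer counters than items the table is eventually full. -/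
lemma ae_eventually_full [IsProbabilityMeasure μ] (h : IsZipfStream μ α D X) (hα₀ : 0 < α)
    (hsel : IsArgmin sel) (hm : 1 ≤ m) (hmD : m < D) (B : ℕ → Ω → Bool) :
    ∀ᵐ ω ∂μ, ∀ᶠ t in atTop,
      (rapRun sel m (fun s => X s ω) (fun s => B s ω) t).C.card = m := by
  have hD : 1 ≤ D := by omega
  have hΓ := zipfGamma_pos hα₀ hD
  have hpos : 0 < (D : ℝ) ^ (-α) / zipfGamma α D :=
    div_pos (Real.rpow_pos_of_pos (by exact_mod_cast hD) _) hΓ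
  filter_upwards [h.ae_arrivals hα₀ hD (half_pos hpos)] with ω hω
  filter_upwards [hω, eventually_gt_atTop 0] with t ht ht0
  have ht' : (0 : ℝ) < t := by exact_mod_cast ht0
  refine le_antisymm (card_rapRun_le hsel t) ?_
  by_contra hlt
  have hsub : Finset.Icc 1 D ⊆ (rapRun sel m (fun s => X s ω) (fun s => B s ω) t).C := by
    intro j hj
    by_contra hmem
    have h0 := arrivals_eq_zero_of_lt j t (not_le.1 hlt) hmem
    have h1 := (abs_le.1 (ht j)).1
    have h2 : (D : ℝ) ^ (-α) / zipfGamma α D ≤ zipfWeight α D j := by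
      rw [zipfWeight_of_mem hj]
      rw [Finset.mem_Icc] at hj
      refine div_le_div_of_nonneg_right ?_ hΓ.le
      exact Real.rpow_le_rpow_of_nonpos (by exact_mod_cast hj.1) (by exact_mod_cast hj.2)
        (by linarith)
    have h3 := mul_le_mul_of_nonneg_right h2 ht'.le
    rw [h0] at h1
    have h4 := mul_pos hpos ht'
    push_cast at h1
    linarith
  have := Finset.card_le_card hsub
  rw [Nat.card_Icc] at this
  omega

/-- Randomized admission solves top-`k` if the minimum, which grows at most at the rate
`(ps + P) / m`, stays below the gap between the probabilities of the items `k` and `k + 1`, and if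
the items up to `k` arrive often enough to be monitored forever from some time on. -/
lemma rapSolves_of_gap [IsProbabilityMeasure μ] {B : ℕ → Ω → Bool} {P ps : ℝ}
    (h : IsZipfStream μ α D X) (hB : IsAdmissionCoins μ P X B) (hα₀ : 0 < α)
    (hk : 1 ≤ k) (hkD : k ≤ D) (hsel : IsArgmin sel) (hm : 1 ≤ m) (hmD : m < D)
    (hps : ∀ S : Finset ℕ, S.card ≤ m → ∑ j ∈ S, zipfWeight α D j ≤ ps)
    (hP : 0 < P) (hpsP : ps ≤ P) (hps2 : ps ≤ 1 / 2)
    (hrate : 2 / m * ps / P + 22 / m * P < (k : ℝ) ^ (-α) / zipfGamma α D)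
    (hgap : ((k + 1 : ℕ) : ℝ) ^ (-α) / zipfGamma α D + (ps + P) / m <
      (k : ℝ) ^ (-α) / zipfGamma α D) :
    RapSolves μ X B sel k m := by
  have hD : 1 ≤ D := hk.trans hkD
  have hΓ := zipfGamma_pos hα₀ hD
  have hm' : (0 : ℝ) < m := by exact_mod_cast hm
  set p := (k : ℝ) ^ (-α) / zipfGamma α D with hp
  set p' := ((k + 1 : ℕ) : ℝ) ^ (-α) / zipfGamma α D with hp'
  set ε := (p - (p' + (ps + P) / m)) / 5 with hε
  have hε0 : 0 < ε := by rw [hε]; linarith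
  have hp'0 : 0 ≤ p' := by positivity
  have hpi : ∀ i ∈ Finset.Icc 1 k, p ≤ zipfWeight α D i := by
    intro i hi
    rw [Finset.mem_Icc] at hi
    rw [zipfWeight_of_mem (Finset.mem_Icc.2 ⟨hi.1, hi.2.trans hkD⟩)]
    refine div_le_div_of_nonneg_right ?_ hΓ.le
    exact Real.rpow_le_rpow_of_nonpos (by exact_mod_cast hi.1) (by exact_mod_cast hi.2)
      (by linarith)
  have hfull := ae_eventually_full h hα₀ hsel hm hmD B
  have hmem : ∀ᵐ ω ∂μ, ∀ i ∈ Finset.Icc 1 k, ∀ᶠ t in atTop,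
      i ∈ (rapRun sel m (fun s => X s ω) (fun s => B s ω) t).C := by
    rw [ae_all_iff]
    intro i
    by_cases hi : i ∈ Finset.Icc 1 k
    · have h1 : zipfWeight α D i ≤ P := by
        have := hps {i} (by simpa using hm)
        rw [Finset.sum_singleton] at this
        linarith
      filter_upwards [ae_eventually_mem h.measurable h.indep (h.measureReal_eq hα₀ hD) hB hsel hm
        hps hfull hP hpsP hps2 h1 (hrate.trans_le (hpi i hi))] with ω hω _
      exact hω
    · exact ae_of_all _ fun _ hi' => absurd hi' hi
  have htot := ae_eventually_total_le h.measurable h.indep (h.measureReal_eq hα₀ hD) hB hsel hm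
    hps hfull hP.le (q := ps + P + ε * m) (by linarith [mul_pos hε0 hm'])
  refine tendsto_measureReal_one_of_ae (fun t =>
    measurableSet_identifiesTop h.measurable hB.measurable sel k m t) ?_
  filter_upwards [h.ae_arrivals hα₀ hD hε0, hmem, htot] with ω hω hmem htot
  obtain ⟨t₁, ht₁⟩ := eventually_atTop.1 ((Finset.Icc 1 k).eventually_all.2 hmem)
  have hconst : ∀ᶠ t : ℕ in atTop, ∀ i ∈ Finset.Icc 1 k,
      (arrivals (fun s => X s ω) i t₁ : ℝ) ≤ ε * t :=
    (Finset.Icc 1 k).eventually_all.2 fun i _ =>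
      (tendsto_natCast_atTop_atTop.const_mul_atTop hε0).eventually_ge_atTop _
  filter_upwards [hω, htot, hconst, eventually_ge_atTop t₁, eventually_gt_atTop 0]
    with t ht htot hconst ht1 ht0
  have ht' : (0 : ℝ) < t := by exact_mod_cast ht0
  have hlev : (level sel m (rapRun sel m (fun s => X s ω) (fun s => B s ω) t) : ℝ) ≤
      ((ps + P) / m + ε) * t := by
    have h1 := mul_level_le_total hsel
      (card_rapRun_le (m := m) (x := fun s => X s ω) (b := fun s => B s ω) hsel t)
    have h2 : (m : ℝ) * level sel m (rapRun sel m (fun s => X s ω) (fun s => B s ω) t) ≤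
        (rapRun sel m (fun s => X s ω) (fun s => B s ω) t).total := by exact_mod_cast h1
    rw [show ((ps + P) / m + ε) * t = (ps + P + ε * m) * t / m by field_simp, le_div_iff₀ hm']
    linarith
  have hsep : (p' + (ps + P) / m + 2 * ε) * t < (p - 2 * ε) * t :=
    mul_lt_mul_of_pos_right (by rw [hε]; linarith) ht'
  refine identifiesTop_of_threshold ((p' + (ps + P) / m + 2 * ε) * t) (fun i hi => ?_)
    (fun j hj hjk => ?_)
  · refine ⟨ht₁ t ht1 i hi, ?_⟩
    have h1 := (abs_le.1 (ht i)).1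
    have h2 : p * t ≤ zipfWeight α D i * t := mul_le_mul_of_nonneg_right (hpi i hi) ht'.le
    have h3 : (arrivals (fun s => X s ω) i t : ℝ) ≤ arrivals (fun s => X s ω) i t₁ +
        (rapRun sel m (fun s => X s ω) (fun s => B s ω) t).c i := by
      exact_mod_cast arrivals_sub_le_counter hsel hm i t₁ t ht1 fun s hs => ht₁ s hs i hi
    linarith [hconst i hi]
  · have h1 := (abs_le.1 (ht j)).2
    have h2 : (((rapRun sel m (fun s => X s ω) (fun s => B s ω) t).c j : ℕ) : ℝ) ≤
        arrivals (fun s => X s ω) j t +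
          level sel m (rapRun sel m (fun s => X s ω) (fun s => B s ω) t) := by
      exact_mod_cast rapRun_counter_le hsel hm j t hj
    have hpj : zipfWeight α D j ≤ p' := by
      rcases Nat.eq_zero_or_pos j with rfl | hj0
      · rw [zipfWeight, if_neg (by simp)]; exact hp'0
      · rw [Finset.mem_Icc] at hjk
        exact zipfWeight_le hα₀ hD (by omega) (by omega)
    have h3 : zipfWeight α D j * t ≤ p' * t := mul_le_mul_of_nonneg_right hpj ht'.le
    linarith

end Solves

/-! ### The number of counters -/

/-- The conditions of the randomized admission algorithm hold for `m` of the order `M`, where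
`P = M ^ (-α)` and the normalizing constant `Γ` is of the order `M ^ (1 + α)`. -/
lemma rap_conditions {α M Γ c₀ c m y y' : ℝ} (hα₀ : 0 < α) (hα₁ : α < 1) (hM : 0 < M)
    (hΓ₁ : M ^ (1 + α) ≤ Γ) (hΓ₂ : (1 - α) * Γ ≤ M ^ (1 + α)) (hc₀ : 0 < c₀)
    (hm₁ : c₀ * M ≤ m) (hm₂ : m ≤ c * M) (hy' : 0 ≤ y')
    (hM₁ : 2 ≤ M ^ α) (hM₂ : 2 * c ^ (1 - α) / (1 - α) ≤ M ^ α)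
    (hc : 4 * c₀ ^ (-α) + 22 * c₀⁻¹ < (1 - α) * (y - y')) :
    2 * m ^ (1 - α) / ((1 - α) * Γ) ≤ M ^ (-α) ∧
    2 * m ^ (1 - α) / ((1 - α) * Γ) ≤ 1 / 2 ∧
    2 / m * (2 * m ^ (1 - α) / ((1 - α) * Γ)) / M ^ (-α) + 22 / m * M ^ (-α) < y / Γ ∧
    y' / Γ + (2 * m ^ (1 - α) / ((1 - α) * Γ) + M ^ (-α)) / m < y / Γ := by
  have hα : 0 < 1 - α := by linarith
  have hΓ : 0 < Γ := (Real.rpow_pos_of_pos hM _).trans_le hΓ₁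
  have hm : 0 < m := (mul_pos hc₀ hM).trans_le hm₁
  have hc0 : 0 < c := by
    by_contra hneg
    have := mul_nonpos_of_nonpos_of_nonneg (not_lt.1 hneg) hM.le
    linarith
  have hMα : 0 < M ^ α := Real.rpow_pos_of_pos hM _
  have hMinv : M ^ (-α) = (M ^ α)⁻¹ := Real.rpow_neg hM.le _
  have hP : 0 < M ^ (-α) := Real.rpow_pos_of_pos hM _
  have hM1 : M ^ (1 + α) = M * M ^ α := by rw [Real.rpow_add hM, Real.rpow_one]
  have hMs : M ^ (1 - α) = M / M ^ α := by rw [Real.rpow_sub hM, Real.rpow_one]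
  have h1 : 2 * m ^ (1 - α) / ((1 - α) * Γ) ≤ M ^ (-α) := by
    rw [div_le_iff₀ (by positivity)]
    have e1 : m ^ (1 - α) ≤ c ^ (1 - α) * M ^ (1 - α) := by
      rw [← Real.mul_rpow hc0.le hM.le]
      exact Real.rpow_le_rpow hm.le hm₂ hα.le
    have e2 : 2 * c ^ (1 - α) ≤ M ^ α * (1 - α) := (div_le_iff₀ hα).1 hM₂
    have e3 : M ^ (-α) * ((1 - α) * M ^ (1 + α)) ≤ M ^ (-α) * ((1 - α) * Γ) := by gcongr
    have e4 : M ^ (-α) * ((1 - α) * M ^ (1 + α)) = M ^ α * (1 - α) * (M / M ^ α) := by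
      rw [hMinv, hM1]; field_simp
    calc 2 * m ^ (1 - α) ≤ 2 * c ^ (1 - α) * M ^ (1 - α) := by linarith
      _ ≤ M ^ α * (1 - α) * (M / M ^ α) := by
          rw [hMs]; exact mul_le_mul_of_nonneg_right e2 (by positivity)
      _ ≤ _ := e4 ▸ e3
  have h2 : M ^ (-α) ≤ 1 / 2 := by
    rw [hMinv, one_div]; exact inv_anti₀ two_pos hM₁
  -- `M ^ (-α) / m` is at most `c₀⁻¹ / M ^ (1 + α)`
  have h3 : M ^ (-α) / m ≤ c₀⁻¹ / ((1 - α) * Γ) := by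
    calc M ^ (-α) / m ≤ M ^ (-α) / (c₀ * M) := by gcongr
      _ = c₀⁻¹ / M ^ (1 + α) := by rw [hMinv, hM1]; field_simp
      _ ≤ _ := by gcongr
  have h4 : m ^ (-α) ≤ c₀ ^ (-α) * M ^ (-α) := by
    rw [← Real.mul_rpow hc₀.le hM.le]
    exact Real.rpow_le_rpow_of_nonpos (by positivity) hm₁ (by linarith)
  have h5 : 2 / m * (2 * m ^ (1 - α) / ((1 - α) * Γ)) / M ^ (-α) ≤
      4 * c₀ ^ (-α) / ((1 - α) * Γ) := by
    have e1 : m ^ (1 - α) = m * m ^ (-α) := by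
      rw [show 1 - α = 1 + -α by ring, Real.rpow_add hm, Real.rpow_one]
    rw [e1, div_le_iff₀ hP]
    calc 2 / m * (2 * (m * m ^ (-α)) / ((1 - α) * Γ)) = 4 * m ^ (-α) / ((1 - α) * Γ) := by
          field_simp; ring
      _ ≤ 4 * (c₀ ^ (-α) * M ^ (-α)) / ((1 - α) * Γ) := by gcongr
      _ = _ := by ring
  have h6 : (4 * c₀ ^ (-α) + 22 * c₀⁻¹) / ((1 - α) * Γ) < (y - y') / Γ := by
    rw [div_lt_div_iff₀ (by positivity) hΓ]
    calc (4 * c₀ ^ (-α) + 22 * c₀⁻¹) * Γ < (1 - α) * (y - y') * Γ :=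
          mul_lt_mul_of_pos_right hc hΓ
      _ = _ := by ring
  rw [add_div, sub_div] at h6
  have h7 : 0 ≤ y' / Γ := by positivity
  have h8 : 0 < 4 * c₀ ^ (-α) / ((1 - α) * Γ) := by positivity
  have h9 : 0 < c₀⁻¹ / ((1 - α) * Γ) := by positivity
  have h10 : 22 * c₀⁻¹ / ((1 - α) * Γ) = 22 * (c₀⁻¹ / ((1 - α) * Γ)) := by ring
  refine ⟨h1, h1.trans h2, ?_, ?_⟩
  · have : 22 / m * M ^ (-α) = 22 * (M ^ (-α) / m) := by ring
    linarith
  · have : (2 * m ^ (1 - α) / ((1 - α) * Γ) + M ^ (-α)) / m ≤ 2 * (M ^ (-α) / m) := by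
      rw [mul_div_assoc']
      exact div_le_div_of_nonneg_right (by linarith) hm.le
    linarith

theorem theorem1 (α : ℝ) (hα₀ : 0 < α) (hα₁ : α < 1) (k : ℕ) (hk : 1 ≤ k) :
    -- Space Saving: `Θ(D^{1-α})` counters are necessary and sufficient
    (∃ c C : ℝ, 0 < c ∧ 0 < C ∧ ∀ᶠ D : ℕ in atTop,
      ∀ (Ω : Type*) [MeasurableSpace Ω] (μ : Measure Ω) [IsProbabilityMeasure μ]
        (X : ℕ → Ω → ℕ) (sel : CounterTable → ℕ),
        IsZipfStream μ α D X → IsArgmin sel →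
        (∀ m : ℕ, SpaceSavingSolves μ X sel k m → c * (D : ℝ) ^ (1 - α) ≤ (m : ℝ)) ∧
        (∀ m : ℕ, C * (D : ℝ) ^ (1 - α) ≤ (m : ℝ) → SpaceSavingSolves μ X sel k m)) ∧
    -- RAP' with admission probability `P = D^{(α²-α)/(1+α)}`: a number of counters of the order
    -- `D^{(1-α)/(1+α)}`, with a large enough constant, is sufficient
    (∃ c₀ : ℝ, 0 < c₀ ∧ ∀ c : ℝ, c₀ ≤ c → ∀ᶠ D : ℕ in atTop,
      ∀ (Ω : Type*) [MeasurableSpace Ω] (μ : Measure Ω) [IsProbabilityMeasure μ]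
        (X : ℕ → Ω → ℕ) (B : ℕ → Ω → Bool) (sel : CounterTable → ℕ),
        IsZipfStream μ α D X →
        IsAdmissionCoins μ ((D : ℝ) ^ ((α ^ 2 - α) / (1 + α))) X B → IsArgmin sel →
        ∀ m : ℕ, c₀ * (D : ℝ) ^ ((1 - α) / (1 + α)) ≤ (m : ℝ) →
          (m : ℝ) ≤ c * (D : ℝ) ^ ((1 - α) / (1 + α)) → RapSolves μ X B sel k m) := by
  have hα : 0 < 1 - α := by linarith
  have hk' : (0 : ℝ) < k := by exact_mod_cast hk
  set y : ℝ := (k : ℝ) ^ (-α) with hy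
  set y' : ℝ := ((k + 1 : ℕ) : ℝ) ^ (-α) with hy'
  have hgap : 0 < y - y' := by
    have : y' < y := Real.rpow_lt_rpow_of_neg hk' (by push_cast; linarith) (by linarith)
    linarith
  have hy'0 : 0 ≤ y' := by positivity
  constructor
  · refine ⟨1 / k, 2 / ((1 - α) * (y - y')), by positivity, by positivity, ?_⟩
    filter_upwards [eventually_ge_atTop (k + 1)] with D hD Ω _ μ _ X sel hX hsel
    have hD1 : 1 ≤ D := by omega
    have hD0 : (0 : ℝ) < D := by exact_mod_cast hD1
    have hΓ := zipfGamma_pos hα₀ hD1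
    have hDα : 0 < (D : ℝ) ^ (1 - α) := Real.rpow_pos_of_pos hD0 _
    refine ⟨fun m hm => ?_, fun m hm => ?_⟩
    · have hm1 : 1 ≤ m := by
        by_contra hm0
        obtain rfl : m = 0 := by omega
        -- a table without counters never identifies anything
        have h0 : ∀ t, {ω | IdentifiesTop k (spaceSavingRun sel 0 (fun s => X s ω) t)} = ∅ := by
          intro t
          ext ω
          simp only [Set.mem_ofPred_eq, Set.mem_empty_iff_false, iff_false]
          intro hid
          have h1 : (spaceSavingRun sel 0 (fun s => X s ω) t).C.card ≤ 0 := card_rapRun_le hsel t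
          have h2 := (hid 1 (by simp [hk])).1
          rw [Finset.card_eq_zero.1 (Nat.le_zero.1 h1)] at h2
          simp at h2
        have h3 := hm
        simp only [SpaceSavingSolves, h0, measureReal_empty] at h3
        exact zero_ne_one (tendsto_nhds_unique tendsto_const_nhds h3)
      have h1 := one_le_of_spaceSavingSolves hX.measurable hk hsel hm1 (fun t =>
        measureReal_mem_finset (hX.measurable t) (hX.measureReal_eq hα₀ hD1 t) _) hm
      have h2 : ∑ i ∈ Finset.Icc 1 k, zipfWeight α D i ≤ k / (D : ℝ) ^ (1 - α) := by
        have h3 := Finset.sum_le_card_nsmul (Finset.Icc 1 k) (zipfWeight α D)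
          (1 / (D : ℝ) ^ (1 - α)) (fun i hi => by
            refine (zipfWeight_le hα₀ hD1 le_rfl (Finset.mem_Icc.1 hi).1).trans ?_
            rw [Nat.cast_one, Real.one_rpow]
            exact one_div_le_one_div_of_le hDα (rpow_le_zipfGamma hα₀ hD1))
        rw [Nat.card_Icc, Nat.add_sub_cancel, nsmul_eq_mul] at h3
        simpa [div_eq_mul_inv] using h3
      have h3 : 1 ≤ (m : ℝ) * (k / (D : ℝ) ^ (1 - α)) :=
        h1.trans (mul_le_mul_of_nonneg_left h2 (Nat.cast_nonneg m))
      rw [mul_div_assoc', le_div_iff₀ hDα] at h3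
      rw [div_mul_eq_mul_div, div_le_iff₀ hk']
      exact h3
    · have hm0 : (0 : ℝ) < m := lt_of_lt_of_le (by positivity) hm
      refine spaceSavingSolves_of_gap hX hα₀ hk (by omega) hsel (by exact_mod_cast hm0) ?_
      have h1 : 1 / (m : ℝ) < (y - y') / zipfGamma α D := by
        rw [div_lt_div_iff₀ hm0 hΓ, one_mul]
        have h2 := mul_zipfGamma_le hα₀ hα₁ D
        have h3 : 2 / ((1 - α) * (y - y')) * ((1 - α) * zipfGamma α D) ≤ m :=
          (mul_le_mul_of_nonneg_left h2 (by positivity)).trans hm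
        have h4 : 2 / ((1 - α) * (y - y')) * ((1 - α) * zipfGamma α D) =
            2 * zipfGamma α D / (y - y') := by field_simp
        rw [h4, div_le_iff₀ hgap] at h3
        linarith
      rw [sub_div] at h1
      linarith
  · have hlim : Tendsto (fun c : ℝ => 4 * c ^ (-α) + 22 * c⁻¹) atTop (𝓝 (4 * 0 + 22 * 0)) :=
      ((tendsto_rpow_neg_atTop hα₀).const_mul 4).add (tendsto_inv_atTop_zero.const_mul 22)
    obtain ⟨c₀, hc₀0, hc₀⟩ := ((eventually_gt_atTop (0 : ℝ)).and
      (hlim.eventually_lt_const (u := (1 - α) * (y - y')) (by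
        rw [mul_zero, mul_zero, add_zero]; positivity))).exists
    refine ⟨c₀, hc₀0, fun c hc => ?_⟩
    set e : ℝ := (1 - α) / (1 + α) with he
    have he0 : 0 < e := by positivity
    have he1 : 0 < 1 - e := by
      rw [he, sub_pos, div_lt_one (by linarith)]; linarith
    have hMα : Tendsto (fun D : ℕ => ((D : ℝ) ^ e) ^ α) atTop atTop :=
      (tendsto_rpow_atTop hα₀).comp ((tendsto_rpow_atTop he0).comp tendsto_natCast_atTop_atTop)
    have hMD : Tendsto (fun D : ℕ => (D : ℝ) ^ (1 - e)) atTop atTop :=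
      (tendsto_rpow_atTop he1).comp tendsto_natCast_atTop_atTop
    filter_upwards [eventually_ge_atTop (k + 1), hMα.eventually_ge_atTop 2,
      hMα.eventually_ge_atTop (2 * c ^ (1 - α) / (1 - α)), hMD.eventually_gt_atTop c]
      with D hD hM₁ hM₂ hM₃ Ω _ μ _ X B sel hX hB hsel m hm₁ hm₂
    have hD1 : 1 ≤ D := by omega
    have hD0 : (0 : ℝ) < D := by exact_mod_cast hD1
    have hM : 0 < (D : ℝ) ^ e := Real.rpow_pos_of_pos hD0 _
    have hm0 : (0 : ℝ) < m := (mul_pos hc₀0 hM).trans_le hm₁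
    have hm1 : 1 ≤ m := by exact_mod_cast hm0
    have hmD : m < D := by
      have h1 : c * (D : ℝ) ^ e < (D : ℝ) ^ (1 - e) * (D : ℝ) ^ e :=
        mul_lt_mul_of_pos_right hM₃ hM
      rw [← Real.rpow_add hD0, sub_add_cancel, Real.rpow_one] at h1
      exact_mod_cast hm₂.trans_lt h1
    have hPe : (D : ℝ) ^ ((α ^ 2 - α) / (1 + α)) = ((D : ℝ) ^ e) ^ (-α) := by
      rw [← Real.rpow_mul hD0.le]
      congr 1
      rw [he]
      ring
    have hΓe : ((D : ℝ) ^ e) ^ (1 + α) = (D : ℝ) ^ (1 - α) := by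
      rw [← Real.rpow_mul hD0.le, he, div_mul_cancel₀ _ (by linarith)]
    rw [hPe] at hB
    obtain ⟨h1, h2, h3, h4⟩ := rap_conditions (Γ := zipfGamma α D) hα₀ hα₁ hM
      (hΓe ▸ rpow_le_zipfGamma hα₀ hD1) (hΓe ▸ mul_zipfGamma_le hα₀ hα₁ D) hc₀0 hm₁ hm₂ hy'0
      hM₁ hM₂ hc₀
    exact rapSolves_of_gap hX hB hα₀ hk (by omega) hsel hm1 hmD
      (fun S hS => sum_zipfWeight_le hα₀ hα₁ hD1 hm1 S hS) (Real.rpow_pos_of_pos hM _) h1 h2 h3 h4
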